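/- Let $n\ge 1$, $1<p<\infty$ and $\alpha>-1$. Let $\mathbb{B}_n$ be the open unit ball of $\mathbb{C}^n$, let $v$ be Lebesgue measure on $\mathbb{B}_n$ normalized so that $v(\mathbb{B}_n)=1$, and put $$dv_\alpha(z)=c_\alpha(1-|z|^2)^\alpha\,dv(z),\qquad c_\alpha=\frac{\Gamma(n+\alpha+1)}{n!\,\Gamma(\alpha+1)}.$$ Let $A^p_\alpha$ be the space of holomorphic functions on $\mathbb{B}_n$ that belong to $L^p_\alpha=L^p(\mathbb{B}_n,v_\alpha)$, with the norm of $L^p_\alpha$. Write $z\overline{w}=\sum_i z_i\overline{w_i}$ and $$P_\alpha g(z)=\int_{\mathbb{B}_n}\frac{g(w)}{(1-z\overline{w})^{n+1+\alpha}}\,dv_\alpha(w).$$ For $a\in L^\infty(\mathbb{B}_n)$ the Toeplitz operator with symbol $a$ is $T_af=P_\alpha(af)$, $f\in A^p_\alpha$. For $z\in\mathbb{B}_n$ let $\varphi_z$ be the involutive automorphism of $\mathbb{B}_n$ with $\varphi_z(0)=z$, that is, $$\varphi_z(w)=\frac{z-\pi_zw-\sqrt{1-|z|^2}\,(w-\pi_zw)}{1-w\overline{z}},$$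 where $\pi_z$ is the orthogonal projection of $\mathbb{C}^n$ onto $\mathbb{C}z$, and let $\rho(z,w)=|\varphi_z(w)|$ be the pseudohyperbolic metric. Let $\mathcal{A}$ be the algebra of all bounded functions $a:\mathbb{B}_n\to\mathbb{C}$ that are uniformly continuous from $(\mathbb{B}_n,\rho)$ to $(\mathbb{C},|\cdot|)$. Then, for every $a\in L^\infty(\mathbb{B}_n)$, $T_a$ is a well-defined bounded operator on $A^p_\alpha$, and the Toeplitz algebra $\mathcal{T}_{p,\alpha}$, i.e. the norm-closed subalgebra of $\mathcal{L}(A^p_\alpha,A^p_\alpha)$ generated by $\{T_a: a\in L^\infty(\mathbb{B}_n)\}$, equals the norm-closed subalgebra of $\mathcal{L}(A^p_\alpha,A^p_\alpha)$ generated by $\{T_a: a\in\mathcal{A}\}$. -/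

import Mathlib

open MeasureTheory Set
open scoped ENNReal

noncomputable section

namespace Bergman

/-- The space `ℂⁿ` with its Euclidean norm. -/
abbrev Cn (n : ℕ) : Type := EuclideanSpace ℂ (Fin n)

/-- The open unit ball of `ℂⁿ`. -/
def unitBall (n : ℕ) : Set (Cn n) := Metric.ball 0 1

/-- Lebesgue measure on the unit ball, normalized to total mass one. -/
def normalizedVolume (n : ℕ) : Measure (Cn n) :=
  (volume (unitBall n))⁻¹ • volume.restrict (unitBall n)

/-- The constant `c_α = Γ(n + α + 1) / (n! Γ(α + 1))`. -/
def weightConst (n : ℕ) (α : ℝ) : ℝ :=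
  Real.Gamma (n + α + 1) / (n.factorial * Real.Gamma (α + 1))

/-- The measure `dv_α(z) = c_α (1 - |z|²)^α dv(z)` on the unit ball. -/
def weightedVolume (n : ℕ) (α : ℝ) : Measure (Cn n) :=
  (normalizedVolume n).withDensity
    fun z => ENNReal.ofReal (weightConst n α * (1 - ‖z‖ ^ 2) ^ α)

/-- The classes in `L^p(v_α)` which have a representative that is holomorphic on the unit ball. -/
def bergmanSubmodule (n : ℕ) (p : ℝ≥0∞) (α : ℝ) : Submodule ℂ (Lp ℂ p (weightedVolume n α)) where
  carrier := {f | ∃ g : Cn n → ℂ,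
    DifferentiableOn ℂ g (unitBall n) ∧ f =ᵐ[weightedVolume n α] g}
  zero_mem' := ⟨0, differentiableOn_const 0, Lp.coeFn_zero _ _ _⟩
  add_mem' := by
    rintro f₁ f₂ ⟨g₁, hd₁, h₁⟩ ⟨g₂, hd₂, h₂⟩
    exact ⟨g₁ + g₂, hd₁.add hd₂, (Lp.coeFn_add f₁ f₂).trans (h₁.add h₂)⟩
  smul_mem' := by
    rintro c f ⟨g, hd, h⟩
    exact ⟨c • g, hd.const_smul c, (Lp.coeFn_smul c f).trans (h.const_smul c)⟩

/-- The weighted Bergman space `A^p_α` with the norm of `L^p(v_α)`. -/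
def BergmanSpace (n : ℕ) (p : ℝ≥0∞) (α : ℝ) : Type := bergmanSubmodule n p α

instance (n : ℕ) (p : ℝ≥0∞) [Fact (1 ≤ p)] (α : ℝ) : NormedAddCommGroup (BergmanSpace n p α) :=
  inferInstanceAs (NormedAddCommGroup (bergmanSubmodule n p α))

instance (n : ℕ) (p : ℝ≥0∞) [Fact (1 ≤ p)] (α : ℝ) : NormedSpace ℂ (BergmanSpace n p α) :=
  inferInstanceAs (NormedSpace ℂ (bergmanSubmodule n p α))

/-- The function underlying an element of `A^p_α` (well defined up to null sets of `v_α`). -/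
def BergmanSpace.toFun {n : ℕ} {p : ℝ≥0∞} {α : ℝ} (f : BergmanSpace n p α) : Cn n → ℂ :=
  (Subtype.val f : Lp ℂ p (weightedVolume n α))

/-- The integral operator `P_α g (z) = ∫ g(w) / (1 - z w̄)^(n+1+α) dv_α(w)`. Here
`inner ℂ w z = ∑ i, z i * conj (w i)`, and `1 - z w̄` has positive real part for `z`, `w` in
the ball, so that the power is the principal one. -/
def bergmanProjection (n : ℕ) (α : ℝ) (g : Cn n → ℂ) (z : Cn n) : ℂ :=
  ∫ w, g w / (1 - inner ℂ w z) ^ ((n : ℂ) + 1 + (α : ℂ)) ∂(weightedVolume n α)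

/-- The bounded operator `T` on `A^p_α` is the Toeplitz operator `T_a : f ↦ P_α (a f)`. -/
def IsToeplitz {n : ℕ} {p : ℝ≥0∞} [Fact (1 ≤ p)] {α : ℝ} (a : Cn n → ℂ)
    (T : BergmanSpace n p α →L[ℂ] BergmanSpace n p α) : Prop :=
  ∀ f : BergmanSpace n p α,
    (T f).toFun =ᵐ[weightedVolume n α] bergmanProjection n α (fun w => a w * f.toFun w)

/-- The norm-closed subalgebra of the bounded operators on `A^p_α` generated by the Toeplitz
operators whose symbol belongs to the class `A` of functions. -/
def closedToeplitzAlgebra {n : ℕ} (p : ℝ≥0∞) [Fact (1 ≤ p)] (α : ℝ) (A : Set (Cn n → ℂ)) :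
    NonUnitalSubalgebra ℂ (BergmanSpace n p α →L[ℂ] BergmanSpace n p α) :=
  (NonUnitalAlgebra.adjoin ℂ
    {T : BergmanSpace n p α →L[ℂ] BergmanSpace n p α | ∃ a ∈ A, IsToeplitz a T}
    ).topologicalClosure

/-- The symbols in `L^∞`; only the values almost everywhere on the ball matter. -/
def boundedSymbols (n : ℕ) (α : ℝ) : Set (Cn n → ℂ) :=
  {a | MemLp a ∞ (weightedVolume n α)}

/-- The Toeplitz algebra `𝒯_{p,α}`. -/
def toeplitzAlgebra (n : ℕ) (p : ℝ≥0∞) [Fact (1 ≤ p)] (α : ℝ) :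
    NonUnitalSubalgebra ℂ (BergmanSpace n p α →L[ℂ] BergmanSpace n p α) :=
  closedToeplitzAlgebra p α (boundedSymbols n α)

/-- The orthogonal projection of `w` onto the line `ℂ z` (zero if `z = 0`). -/
def lineProj {n : ℕ} (z w : Cn n) : Cn n := (inner ℂ z w / ((‖z‖ ^ 2 : ℝ) : ℂ)) • z

/-- The involutive automorphism of the ball with `φ_z(0) = z`, namely
`φ_z(w) = (z - P_z w - √(1 - |z|²) (w - P_z w)) / (1 - w z̄)`
with `P_z` the orthogonal projection onto `ℂ z`. -/
def ballAut {n : ℕ} (z w : Cn n) : Cn n :=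
  (1 - inner ℂ z w)⁻¹ •
    (z - lineProj z w - ((Real.sqrt (1 - ‖z‖ ^ 2) : ℝ) : ℂ) • (w - lineProj z w))

/-- The pseudohyperbolic metric `ρ(z, w) = |φ_z(w)|` on the ball. -/
def pseudohyp {n : ℕ} (z w : Cn n) : ℝ := ‖ballAut z w‖

/-- The algebra `𝒜` of the functions that are bounded on the ball and uniformly continuous from
the ball with the metric `ρ` to `ℂ`; only the values on the ball matter. -/
def uniformSymbols (n : ℕ) : Set (Cn n → ℂ) :=
  {a | (∃ C : ℝ, ∀ z ∈ unitBall n, ‖a z‖ ≤ C) ∧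
    ∀ ε > 0, ∃ δ > 0, ∀ z ∈ unitBall n, ∀ w ∈ unitBall n,
      pseudohyp z w < δ → ‖a z - a w‖ < ε}

end Bergman

end

/-! Write λ for `invariantMeasure`, D for the density of v_α with respect to λ, K for the Bergman
kernel and P⁺ for `absProjection`, the operator with kernel |K|. Only one inclusion has content, and
it needs no products of operators: each T_a with bounded a is itself a norm limit of operators T_b
with b uniformly continuous for ρ.

The symbol b is the average `regularize` of a against a bump β(u, w) that depends only on ρ(u, w)
and vanishes for ρ(u, w) ≥ t. The involutions preserve λ (`measurePreserving_ballAut`), so the bump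
has the same mass C around every point. Put H = D f K(x, ·), so that T_a f(x) = ∫ a H dλ. Fubini
moves the average from a to H, and C (T_a f - T_b f)(x) becomes the double integral of β(u, w) a(w)
(H(w) - H(u)). Where β is nonzero, u and w are ρ-close and H hardly changes: D and K have small
relative variation, uniformly in x, and by `reproducing_formula` f(w) - f(u) is, up to a constant,
an integral of f against a difference of kernels, hence small relative to ∫ |f K(w, ·)| dv_α. If |a|
≤ M, this yields |T_a f - T_b f| ≤ M ε P⁺P⁺|f| pointwise (`exists_enorm_bergmanProjection_sub_le`).

P⁺ is bounded on L^p (`absProjection_rpow_le`) by Schur's test with powers of 1 - |w|², the test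
inequalities being the estimate `forelli_rudin`. So the operator norm of T_a - T_b is O(ε). That b
lies in 𝒜 is `regularize_mem_uniformSymbols`. -/

noncomputable section

namespace Bergman

/-! ### Involutions of the ball and the invariant measure -/

section BallAut

variable {n : ℕ}

/-- The number `√(1 - |z|²)`. -/
def defect (z : Cn n) : ℝ := Real.sqrt (1 - ‖z‖ ^ 2)

lemma mem_unitBall {z : Cn n} : z ∈ unitBall n ↔ ‖z‖ < 1 := by simp [unitBall]

lemma isOpen_unitBall : IsOpen (unitBall n) := Metric.isOpen_ball

lemma measurableSet_unitBall : MeasurableSet (unitBall n) := isOpen_unitBall.measurableSet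

lemma one_sub_norm_sq_pos {z : Cn n} (hz : z ∈ unitBall n) : 0 < 1 - ‖z‖ ^ 2 := by
  rw [mem_unitBall] at hz
  nlinarith [norm_nonneg z]

lemma defect_sq {z : Cn n} (hz : z ∈ unitBall n) : defect z ^ 2 = 1 - ‖z‖ ^ 2 :=
  Real.sq_sqrt (one_sub_norm_sq_pos hz).le

lemma defect_pos {z : Cn n} (hz : z ∈ unitBall n) : 0 < defect z :=
  Real.sqrt_pos.2 (one_sub_norm_sq_pos hz)

lemma inner_self_eq_ofReal (z : Cn n) : inner ℂ z z = ((‖z‖ ^ 2 : ℝ) : ℂ) := by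
  rw [inner_self_eq_norm_sq_to_K]
  simp

lemma inner_self_eq_defect {z : Cn n} (hz : z ∈ unitBall n) :
    inner ℂ z z = 1 - (defect z : ℂ) ^ 2 := by
  rw [inner_self_eq_ofReal, ← Complex.ofReal_pow, defect_sq hz]
  simp

lemma norm_inner_lt_one {z w : Cn n} (hz : z ∈ unitBall n) (hw : w ∈ unitBall n) :
    ‖inner ℂ z w‖ < 1 := by
  rw [mem_unitBall] at hz hw
  calc ‖inner ℂ z w‖ ≤ ‖z‖ * ‖w‖ := norm_inner_le_norm z w
    _ < 1 := by nlinarith [norm_nonneg z, norm_nonneg w]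

lemma re_one_sub_inner_pos {z w : Cn n} (hz : z ∈ unitBall n) (hw : w ∈ unitBall n) :
    0 < (1 - inner ℂ z w).re := by
  have h := (Complex.re_le_norm (inner ℂ z w)).trans_lt (norm_inner_lt_one hz hw)
  simp only [Complex.sub_re, Complex.one_re]
  linarith

lemma one_sub_inner_ne_zero {z w : Cn n} (hz : z ∈ unitBall n) (hw : w ∈ unitBall n) :
    1 - inner ℂ z w ≠ 0 := by
  intro h
  have := re_one_sub_inner_pos hz hw
  simp [h] at this

/-- With s = `defect z`, |z|² = (1 - s)(1 + s) cancels the factor 1 - s. Only 1 + s remains in the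
denominator, so later computations need no separate case z = 0. -/
lemma ballAut_eq {z : Cn n} (hz : z ∈ unitBall n) (w : Cn n) :
    ballAut z w = (1 - inner ℂ z w)⁻¹ •
      (z - (defect z : ℂ) • w - (inner ℂ z w / (1 + (defect z : ℂ))) • z) := by
  have hs := defect_pos hz
  have hs1 : (1 + (defect z : ℂ)) ≠ 0 := by
    exact_mod_cast (by linarith : (1 + defect z) ≠ 0)
  rcases eq_or_ne z 0 with rfl | hz0
  · simp [ballAut, lineProj, defect]
  have hn : ((‖z‖ ^ 2 : ℝ) : ℂ) ≠ 0 := by simpa using hz0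
  have e1 : ((‖z‖ ^ 2 : ℝ) : ℂ) = (1 - defect z) * (1 + defect z) := by
    have := defect_sq hz
    have h2 : ‖z‖ ^ 2 = (1 - defect z) * (1 + defect z) := by linarith
    rw [h2]; push_cast; ring
  have hd : (1 - (defect z : ℂ)) ≠ 0 := by
    intro h; rw [e1, h, zero_mul] at hn; exact hn rfl
  unfold ballAut lineProj
  congr 1
  rw [e1]
  change z - _ • z - (defect z : ℂ) • (w - _ • z) = _
  match_scalars
  · field_simp; ring
  · ring

/-- The basic identity for φ_z: the diagonal w = u gives the transformation law of 1 - |w|², and the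
general case gives the slow variation of the kernel. -/
lemma one_sub_inner_ballAut {z w u : Cn n} (hz : z ∈ unitBall n) (hw : w ∈ unitBall n)
    (hu : u ∈ unitBall n) :
    1 - inner ℂ (ballAut z w) (ballAut z u) =
      (defect z : ℂ) ^ 2 * (1 - inner ℂ w u) / ((1 - inner ℂ w z) * (1 - inner ℂ z u)) := by
  have h1 := one_sub_inner_ne_zero hw hz
  have h2 := one_sub_inner_ne_zero hz hu
  have hs1 : (1 + (defect z : ℂ)) ≠ 0 := by
    exact_mod_cast (by linarith [defect_pos hz] : (1 + defect z) ≠ 0)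
  rw [ballAut_eq hz, ballAut_eq hz]
  simp only [inner_smul_left, inner_smul_right, inner_sub_left, inner_sub_right, map_inv₀,
    map_sub, map_one, map_div₀, map_add, Complex.conj_ofReal, inner_conj_symm,
    inner_self_eq_defect hz]
  field_simp
  ring

lemma inner_ballAut_right {z w : Cn n} (hz : z ∈ unitBall n) (hw : w ∈ unitBall n) :
    1 - inner ℂ z (ballAut z w) = (defect z : ℂ) ^ 2 / (1 - inner ℂ z w) := by
  have h2 := one_sub_inner_ne_zero hz hw
  have hs1 : (1 + (defect z : ℂ)) ≠ 0 := by
    exact_mod_cast (by linarith [defect_pos hz] : (1 + defect z) ≠ 0)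
  rw [ballAut_eq hz]
  simp only [inner_smul_right, inner_sub_right, inner_self_eq_defect hz]
  field_simp
  ring

lemma ballAut_ballAut {z w : Cn n} (hz : z ∈ unitBall n) (hw : w ∈ unitBall n) :
    ballAut z (ballAut z w) = w := by
  have h2 := one_sub_inner_ne_zero hz hw
  have hs := defect_pos hz
  have hs0 : (defect z : ℂ) ≠ 0 := by exact_mod_cast hs.ne'
  have hs1 : (1 + (defect z : ℂ)) ≠ 0 := by
    exact_mod_cast (by linarith : (1 + defect z) ≠ 0)
  have h3 := inner_ballAut_right hz hw
  have h4 : inner ℂ z (ballAut z w) = 1 - (defect z : ℂ) ^ 2 / (1 - inner ℂ z w) := by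
    rw [← h3]; ring
  rw [ballAut_eq hz (ballAut z w), h4, ballAut_eq hz w]
  match_scalars
  · field_simp
    ring
  · field_simp
    ring

lemma one_sub_norm_sq_ballAut {z w : Cn n} (hz : z ∈ unitBall n) (hw : w ∈ unitBall n) :
    1 - ‖ballAut z w‖ ^ 2 = (1 - ‖z‖ ^ 2) * (1 - ‖w‖ ^ 2) / ‖1 - inner ℂ z w‖ ^ 2 := by
  have h := one_sub_inner_ballAut hz hw hw
  have e : (1 - inner ℂ w z) = starRingEnd ℂ (1 - inner ℂ z w) := by simp
  rw [inner_self_eq_ofReal, inner_self_eq_ofReal, e, Complex.conj_mul',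
    ← Complex.ofReal_pow, defect_sq hz] at h
  exact_mod_cast h

lemma ballAut_mem {z w : Cn n} (hz : z ∈ unitBall n) (hw : w ∈ unitBall n) :
    ballAut z w ∈ unitBall n := by
  have h := one_sub_norm_sq_ballAut hz hw
  have hp : 0 < 1 - ‖ballAut z w‖ ^ 2 := by
    rw [h]
    have := norm_pos_iff.2 (one_sub_inner_ne_zero hz hw)
    have h1 := one_sub_norm_sq_pos hz
    have h2 := one_sub_norm_sq_pos hw
    positivity
  rw [mem_unitBall]
  nlinarith [norm_nonneg (ballAut z w)]

lemma ballAut_zero {z : Cn n} : ballAut z 0 = z := by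
  simp [ballAut, lineProj]

lemma zero_mem_unitBall : (0 : Cn n) ∈ unitBall n := by simp [mem_unitBall]

lemma image_ballAut {z : Cn n} (hz : z ∈ unitBall n) :
    ballAut z '' unitBall n = unitBall n := by
  ext w
  constructor
  · rintro ⟨u, hu, rfl⟩
    exact ballAut_mem hz hu
  · intro hw
    exact ⟨ballAut z w, ballAut_mem hz hw, ballAut_ballAut hz hw⟩

lemma injOn_ballAut {z : Cn n} (hz : z ∈ unitBall n) : InjOn (ballAut z) (unitBall n) :=
  fun u hu w hw h => by rw [← ballAut_ballAut hz hu, h, ballAut_ballAut hz hw]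

lemma measurable_ballAut : Measurable fun q : Cn n × Cn n => ballAut q.1 q.2 := by
  have hi : Measurable fun q : Cn n × Cn n => (inner ℂ q.1 q.2 : ℂ) :=
    (continuous_fst.inner continuous_snd).measurable
  have hn : Measurable fun q : Cn n × Cn n => ‖q.1‖ ^ 2 := (continuous_fst.norm.pow 2).measurable
  have hl : Measurable fun q : Cn n × Cn n => lineProj q.1 q.2 :=
    (hi.div (Complex.measurable_ofReal.comp hn)).smul measurable_fst
  have hs : Measurable fun q : Cn n × Cn n => ((Real.sqrt (1 - ‖q.1‖ ^ 2) : ℝ) : ℂ) :=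
    Complex.measurable_ofReal.comp (measurable_const.sub hn).sqrt
  have h1 : Measurable fun q : Cn n × Cn n => (1 - inner ℂ q.1 q.2 : ℂ)⁻¹ :=
    (measurable_const.sub hi).inv
  have h2 : Measurable fun q : Cn n × Cn n => q.1 - lineProj q.1 q.2 -
      ((Real.sqrt (1 - ‖q.1‖ ^ 2) : ℝ) : ℂ) • (q.2 - lineProj q.1 q.2) :=
    (measurable_fst.sub hl).sub (hs.smul (measurable_snd.sub hl))
  simpa only [ballAut, Pi.smul_def'] using h1.smul h2

lemma measurable_ballAut_right (z : Cn n) : Measurable (ballAut z) := by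
  change Measurable ((fun q : Cn n × Cn n => ballAut q.1 q.2) ∘ Prod.mk z)
  exact measurable_ballAut.comp measurable_prodMk_left

/-- The derivative of the involution `φ_z`. -/
def ballAutDeriv (z w : Cn n) : Cn n →L[ℂ] Cn n :=
  (-(1 - inner ℂ z w)⁻¹) • ((defect z : ℂ) • ContinuousLinearMap.id ℂ (Cn n) +
    (innerSL ℂ z).smulRight ((1 + (defect z : ℂ))⁻¹ • z - ballAut z w))

lemma hasFDerivAt_ballAut {z w : Cn n} (hz : z ∈ unitBall n) (hw : w ∈ unitBall n) :
    HasFDerivAt (ballAut z) (ballAutDeriv z w) w := by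
  have h2 := one_sub_inner_ne_zero hz hw
  have hi : HasFDerivAt (fun x : Cn n => (inner ℂ z x : ℂ)) (innerSL ℂ z) w :=
    (innerSL ℂ z).hasFDerivAt
  have hi' : HasFDerivAt (fun x : Cn n => (1 - inner ℂ z x)⁻¹)
      ((-((1 - inner ℂ z w) ^ 2)⁻¹) • (-(innerSL ℂ z))) w :=
    (hasDerivAt_inv h2).comp_hasFDerivAt w (hi.const_sub 1)
  have hN : HasFDerivAt (fun x : Cn n => z - (defect z : ℂ) • x -
      (inner ℂ z x / (1 + (defect z : ℂ))) • z)
      (-((defect z : ℂ) • ContinuousLinearMap.id ℂ (Cn n)) -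
        ((1 + (defect z : ℂ))⁻¹ • innerSL ℂ z).smulRight z) w := by
    refine (((hasFDerivAt_id w).const_smul (defect z : ℂ)).const_sub z).sub
      (HasFDerivAt.smul_const ?_ z)
    simpa only [div_eq_mul_inv] using hi.mul_const ((1 + (defect z : ℂ))⁻¹)
  have h := hi'.smul hN
  have he : ballAut z = fun x => (1 - inner ℂ z x)⁻¹ • (z - (defect z : ℂ) • x -
      (inner ℂ z x / (1 + (defect z : ℂ))) • z) := funext (ballAut_eq hz)
  rw [he]
  refine h.congr_fderiv ?_
  ext1 v
  simp [ballAutDeriv, ballAut_eq hz w]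
  all_goals match_scalars
  all_goals field_simp
  all_goals ring

/-- The operator is s times a transvection, whose determinant is 1 + f(u)/s. The extra factor s on
the left avoids the exponent n - 1. -/
lemma det_smul_id_add_smulRight {s : ℂ} (hs : s ≠ 0) (f : Cn n →L[ℂ] ℂ) (u : Cn n) :
    s * (s • ContinuousLinearMap.id ℂ (Cn n) + f.smulRight u).det = s ^ n * (s + f u) := by
  have h : ((s • ContinuousLinearMap.id ℂ (Cn n) + f.smulRight u : Cn n →L[ℂ] Cn n) :
      Cn n →ₗ[ℂ] Cn n) = s • LinearMap.transvection (f : Cn n →ₗ[ℂ] ℂ) (s⁻¹ • u) := by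
    ext1 v
    simp [LinearMap.transvection, smul_smul, mul_comm (f v), hs]
  rw [ContinuousLinearMap.det, h, LinearMap.det_smul, LinearMap.transvection.det]
  simp
  field_simp

/-- The derivative is a scalar times a rank-one perturbation of s·id, and `inner_ballAut_right`
evaluates the rank-one term, so that the determinant is, up to sign, (s / (1 - ⟨z, w⟩))^(n+1). -/
lemma norm_det_ballAutDeriv_sq {z w : Cn n} (hz : z ∈ unitBall n) (hw : w ∈ unitBall n) :
    ‖(ballAutDeriv z w).det‖ ^ 2 = ((1 - ‖z‖ ^ 2) / ‖1 - inner ℂ z w‖ ^ 2) ^ (n + 1) := by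
  have hs := defect_pos hz
  have hs0 : (defect z : ℂ) ≠ 0 := by exact_mod_cast hs.ne'
  have hs1 : (1 + (defect z : ℂ)) ≠ 0 := by
    exact_mod_cast (by linarith : (1 + defect z) ≠ 0)
  have h2 := one_sub_inner_ne_zero hz hw
  have h := det_smul_id_add_smulRight hs0 (innerSL ℂ z)
    ((1 + (defect z : ℂ))⁻¹ • z - ballAut z w)
  have e : (defect z : ℂ) + innerSL ℂ z ((1 + (defect z : ℂ))⁻¹ • z - ballAut z w) =
      (defect z : ℂ) ^ 2 / (1 - inner ℂ z w) := by
    rw [← inner_ballAut_right hz hw]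
    simp only [innerSL_apply_apply, inner_sub_right, inner_smul_right, inner_self_eq_defect hz]
    field_simp
    ring
  rw [e] at h
  have hd : (ballAutDeriv z w).det = (-(1 - inner ℂ z w)⁻¹) ^ n *
      ((defect z : ℂ) ^ n * (defect z : ℂ) / (1 - inner ℂ z w)) := by
    have h' : ((defect z : ℂ) • ContinuousLinearMap.id ℂ (Cn n) + (innerSL ℂ z).smulRight
        ((1 + (defect z : ℂ))⁻¹ • z - ballAut z w)).det =
        (defect z : ℂ) ^ n * (defect z : ℂ) / (1 - inner ℂ z w) := by
      apply mul_left_cancel₀ hs0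
      rw [h]
      ring
    rw [← h', ballAutDeriv, ContinuousLinearMap.det, ContinuousLinearMap.toLinearMap_smul,
      LinearMap.det_smul, ContinuousLinearMap.det]
    simp
  rw [hd, ← defect_sq hz]
  simp only [norm_mul, norm_pow, norm_div, norm_neg, norm_inv, Complex.norm_real,
    Real.norm_of_nonneg hs.le]
  have := norm_pos_iff.2 h2
  rw [div_pow, ← pow_mul, ← pow_mul, inv_pow]
  field_simp
  ring

lemma det_restrictScalars_eq_norm_sq (A : Cn n →L[ℂ] Cn n) :
    (A.restrictScalars ℝ).det = ‖A.det‖ ^ 2 := by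
  have h := LinearMap.det_restrictScalars (R := ℝ) (S := ℂ) (f := (A : Cn n →ₗ[ℂ] Cn n))
  rw [Algebra.norm_complex_apply, Complex.normSq_eq_norm_sq] at h
  exact h

/-- The Möbius invariant measure `(1 - |w|²)^(-n-1) dw` on the ball. -/
def hyperbolicVolume (n : ℕ) : Measure (Cn n) :=
  (volume.restrict (unitBall n)).withDensity
    fun w => ENNReal.ofReal (((1 - ‖w‖ ^ 2) ^ (n + 1))⁻¹)

lemma measurable_hyperbolicDensity :
    Measurable fun w : Cn n => ENNReal.ofReal (((1 - ‖w‖ ^ 2) ^ (n + 1))⁻¹) := by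
  fun_prop

lemma lintegral_hyperbolicVolume {g : Cn n → ℝ≥0∞} (hg : Measurable g) :
    ∫⁻ w, g w ∂(hyperbolicVolume n) =
      ∫⁻ w in unitBall n, ENNReal.ofReal (((1 - ‖w‖ ^ 2) ^ (n + 1))⁻¹) * g w := by
  rw [hyperbolicVolume, lintegral_withDensity_eq_lintegral_mul _ measurable_hyperbolicDensity hg]
  rfl

/-- The real Jacobian is |det|² of the complex derivative; it is exactly the factor by which (1 -
|w|²)^(n+1) changes under φ_z. -/
theorem measurePreserving_ballAut {z : Cn n} (hz : z ∈ unitBall n) :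
    MeasurePreserving (ballAut z) (hyperbolicVolume n) (hyperbolicVolume n) := by
  refine ⟨measurable_ballAut_right z, ?_⟩
  ext s hs
  have hm : Measurable (s.indicator (1 : Cn n → ℝ≥0∞)) := measurable_one.indicator hs
  rw [Measure.map_apply (measurable_ballAut_right z) hs, ← lintegral_indicator_one hs,
    ← lintegral_indicator_one (measurable_ballAut_right z hs), lintegral_hyperbolicVolume hm,
    lintegral_hyperbolicVolume (measurable_one.indicator (measurable_ballAut_right z hs))]
  conv_rhs => rw [← image_ballAut hz]
  rw [lintegral_image_eq_lintegral_abs_det_fderiv_mul volume measurableSet_unitBall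
    (fun w hw => ((hasFDerivAt_ballAut hz hw).restrictScalars ℝ).hasFDerivWithinAt)
    (injOn_ballAut hz)]
  refine setLIntegral_congr_fun measurableSet_unitBall fun w hw => ?_
  have h1 := one_sub_norm_sq_pos hz
  have h2 := one_sub_norm_sq_pos hw
  have h3 := norm_pos_iff.2 (one_sub_inner_ne_zero hz hw)
  rw [det_restrictScalars_eq_norm_sq, norm_det_ballAutDeriv_sq hz hw,
    abs_of_nonneg (by positivity), ← mul_assoc, ← ENNReal.ofReal_mul (by positivity),
    one_sub_norm_sq_ballAut hz hw]
  refine congrArg₂ _ (congrArg _ ?_) rfl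
  field_simp
  rw [← mul_pow]
  congr 1
  ring

end BallAut

/-! ### The Forelli–Rudin integral on the disc -/

section ForelliRudin

/-- Split at t = δ: a > -1 gives convergence at 0 and b > 0 at infinity. This model integral serves
twice, for the angle (a = 0) and for the radius (a = γ). -/
lemma lintegral_rpow_mul_max_le {a b δ : ℝ} (ha : -1 < a) (hb : 0 < b) (hδ : 0 < δ) :
    ∫⁻ t in Ioi (0 : ℝ), ENNReal.ofReal (t ^ a * (max δ t) ^ (-(a + 1 + b))) ≤
      ENNReal.ofReal ((1 / (a + 1) + 1 / b) * δ ^ (-b)) := by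
  have hsplit : Ioi (0 : ℝ) = Ioc 0 δ ∪ Ioi δ := (Ioc_union_Ioi_eq_Ioi hδ.le).symm
  have ha1 : 0 < a + 1 := by linarith
  have h1 : ∫⁻ t in Ioc (0 : ℝ) δ, ENNReal.ofReal (t ^ a * (max δ t) ^ (-(a + 1 + b))) =
      ENNReal.ofReal (1 / (a + 1) * δ ^ (-b)) := by
    have : ∀ t ∈ Ioc (0 : ℝ) δ, ENNReal.ofReal (t ^ a * (max δ t) ^ (-(a + 1 + b))) =
        ENNReal.ofReal (t ^ a * δ ^ (-(a + 1 + b))) := fun t ht => by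
      rw [max_eq_left ht.2]
    rw [setLIntegral_congr_fun measurableSet_Ioc this, ← ofReal_integral_eq_lintegral_ofReal]
    · rw [integral_mul_const, ← intervalIntegral.integral_of_le hδ.le, integral_rpow (Or.inl ha),
        Real.zero_rpow ha1.ne', sub_zero, div_mul_eq_mul_div, ← Real.rpow_add hδ]
      congr 1
      ring_nf
    · exact (((intervalIntegrable_iff_integrableOn_Ioc_of_le hδ.le).1
        (intervalIntegral.intervalIntegrable_rpow' ha)).mul_const _)
    · filter_upwards [ae_restrict_mem measurableSet_Ioc] with t ht
      have := ht.1
      positivity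
  have h2 : ∫⁻ t in Ioi δ, ENNReal.ofReal (t ^ a * (max δ t) ^ (-(a + 1 + b))) =
      ENNReal.ofReal (1 / b * δ ^ (-b)) := by
    have : ∀ t ∈ Ioi δ, ENNReal.ofReal (t ^ a * (max δ t) ^ (-(a + 1 + b))) =
        ENNReal.ofReal (t ^ (-1 - b)) := fun t ht => by
      rw [max_eq_right (le_of_lt ht), ← Real.rpow_add (hδ.trans ht)]
      congr 2
      ring
    rw [setLIntegral_congr_fun measurableSet_Ioi this, ← ofReal_integral_eq_lintegral_ofReal]
    · rw [integral_Ioi_rpow_of_lt (by linarith) hδ]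
      congr 1
      rw [show (-1 - b + 1) = -b by ring, neg_div_neg_eq, one_div_mul_eq_div]
    · exact integrableOn_Ioi_rpow_of_lt (by linarith) hδ
    · filter_upwards [ae_restrict_mem measurableSet_Ioi] with t ht
      have := hδ.trans ht
      positivity
  calc _ ≤ _ := hsplit ▸ lintegral_union_le _ _ _
    _ = _ := by
      rw [h1, h2, ← ENNReal.ofReal_add (by positivity) (by positivity)]
      congr 1
      ring

/-- The distance from 1 to a point of modulus x is at least 1 - x. The distance from 1 to the ray of
angle θ is |sin θ| when |θ| ≤ π/2 and at least 1 otherwise. -/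
lemma max_le_norm_one_sub_mul_polar {x θ : ℝ} (h0 : 0 ≤ x) (hθ : |θ| < Real.pi) :
    max (1 - x) (|θ| / Real.pi) ≤
      ‖1 - (x : ℂ) * (Real.cos θ + Real.sin θ * Complex.I)‖ := by
  have hsq : ‖1 - (x : ℂ) * (Real.cos θ + Real.sin θ * Complex.I)‖ ^ 2 =
      (1 - x * Real.cos θ) ^ 2 + (x * Real.sin θ) ^ 2 := by
    rw [← Complex.normSq_eq_norm_sq, Complex.normSq_apply]
    simp [-Complex.ofReal_cos, -Complex.ofReal_sin]
    ring
  have hcs := Real.sin_sq_add_cos_sq θ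
  have hcos : Real.cos θ ≤ 1 := Real.cos_le_one θ
  refine max_le ?_ ?_
  · refine le_of_sq_le_sq ?_ (norm_nonneg _)
    rw [hsq]
    nlinarith
  · have hpi := Real.pi_pos
    refine le_of_sq_le_sq ?_ (norm_nonneg _)
    rw [hsq]
    rcases le_or_gt |θ| (Real.pi / 2) with h | h
    · have h3 := Real.mul_abs_le_abs_sin h
      have h4 : |θ| / Real.pi ≤ |Real.sin θ| := by
        refine le_trans ?_ h3
        rw [div_mul_eq_mul_div]
        gcongr
        nlinarith [abs_nonneg θ]
      calc (|θ| / Real.pi) ^ 2 ≤ |Real.sin θ| ^ 2 := by gcongr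
        _ = Real.sin θ ^ 2 := sq_abs _
        _ ≤ _ := by nlinarith [sq_nonneg (x - Real.cos θ)]
    · have hc : Real.cos θ ≤ 0 := by
        rw [← Real.cos_abs]
        exact Real.cos_nonpos_of_pi_div_two_le_of_le h.le (by linarith)
      have h4 : |θ| / Real.pi ≤ 1 := (div_le_one hpi).2 hθ.le
      have h5 : (0 : ℝ) ≤ |θ| / Real.pi := by positivity
      nlinarith [mul_nonneg h0 (neg_nonneg.2 hc), sq_nonneg (x * Real.sin θ),
        sq_nonneg (x * Real.cos θ)]

/-- The previous bound reduces this to the model integral in |θ|. Folding θ to |θ| costs the factor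
2, and the 1/π in the lower bound costs π^(1+κ). -/
lemma lintegral_angle_le {κ x : ℝ} (hκ : 0 < κ) (h0 : 0 ≤ x) (h1 : x < 1) :
    ∫⁻ θ in Ioo (-Real.pi) Real.pi, ENNReal.ofReal
      (‖1 - (x : ℂ) * (Real.cos θ + Real.sin θ * Complex.I)‖ ^ (-(1 + κ))) ≤
    ENNReal.ofReal (2 * Real.pi ^ (1 + κ) * (1 + 1 / κ) * (1 - x) ^ (-κ)) := by
  have hpi := Real.pi_pos
  have hδ : 0 < 1 - x := by linarith
  set F : ℝ → ℝ≥0∞ := fun t => ENNReal.ofReal (Real.pi ^ (1 + κ)) *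
    ENNReal.ofReal (t ^ (0 : ℝ) * (max (1 - x) t) ^ (-(0 + 1 + κ))) with hF
  have hpt : ∀ θ ∈ Ioo (-Real.pi) Real.pi, ENNReal.ofReal
      (‖1 - (x : ℂ) * (Real.cos θ + Real.sin θ * Complex.I)‖ ^ (-(1 + κ))) ≤ F |θ| := by
    intro θ hθ
    have hm := max_le_norm_one_sub_mul_polar h0 (abs_lt.2 hθ)
    rw [hF]
    simp only
    rw [← ENNReal.ofReal_mul (by positivity)]
    refine ENNReal.ofReal_le_ofReal ?_
    have hb : max (1 - x) |θ| / Real.pi ≤ max (1 - x) (|θ| / Real.pi) := by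
      rw [div_le_iff₀ hpi]
      refine max_le ?_ ?_
      · have := le_max_left (1 - x) (|θ| / Real.pi)
        nlinarith [Real.pi_gt_three]
      · calc |θ| = |θ| / Real.pi * Real.pi := by field_simp
          _ ≤ _ := by gcongr; exact le_max_right _ _
    have hmp : 0 < max (1 - x) |θ| := lt_max_of_lt_left hδ
    calc _ ≤ (max (1 - x) |θ| / Real.pi) ^ (-(1 + κ)) :=
          Real.rpow_le_rpow_of_nonpos (by positivity) (hb.trans hm) (by linarith)
      _ = _ := by
        rw [Real.div_rpow hmp.le hpi.le, Real.rpow_neg hpi.le, Real.rpow_zero, zero_add, one_mul,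
          div_inv_eq_mul, mul_comm]
  have hhalf : ∫⁻ t in Ioi (0 : ℝ), F t ≤
      ENNReal.ofReal (Real.pi ^ (1 + κ) * (1 + 1 / κ) * (1 - x) ^ (-κ)) := by
    rw [hF, lintegral_const_mul' _ _ ENNReal.ofReal_ne_top, mul_assoc, ENNReal.ofReal_mul (by positivity)]
    gcongr
    simpa using lintegral_rpow_mul_max_le (a := 0) (by norm_num) hκ hδ
  have hpos : ∫⁻ θ in Ioi (0 : ℝ), F |θ| = ∫⁻ t in Ioi (0 : ℝ), F t :=
    setLIntegral_congr_fun measurableSet_Ioi fun t ht => by rw [abs_of_pos ht]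
  have hneg : ∫⁻ θ in Iio (0 : ℝ), F |θ| = ∫⁻ t in Ioi (0 : ℝ), F t := by
    rw [← hpos, ← lintegral_indicator measurableSet_Iio, ← lintegral_indicator measurableSet_Ioi,
      ← lintegral_neg_eq_self]
    congr 1
    ext θ
    simp [indicator]
  calc _ ≤ ∫⁻ θ in Ioo (-Real.pi) Real.pi, F |θ| := setLIntegral_mono' measurableSet_Ioo hpt
    _ ≤ ∫⁻ θ, F |θ| := setLIntegral_le_lintegral _ _
    _ = ∫⁻ θ in Iio (0 : ℝ) ∪ Ioi 0, F |θ| := by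
      rw [Iio_union_Ioi, setLIntegral_congr (t := univ), setLIntegral_univ]
      exact ae_eq_univ.2 (by simp)
    _ ≤ _ := lintegral_union_le _ _ _
    _ ≤ _ := by
      rw [hneg, hpos]
      refine (add_le_add hhalf hhalf).trans (le_of_eq ?_)
      have : 0 < (1 - x) ^ (-κ) := by positivity
      rw [← ENNReal.ofReal_add (by positivity) (by positivity)]
      congr 1
      ring

/-- `x ^ β` for positive `x`, extended by zero. -/
def posPow (β x : ℝ) : ℝ≥0∞ := if 0 < x then ENNReal.ofReal (x ^ β) else 0

lemma posPow_of_pos {β x : ℝ} (hx : 0 < x) : posPow β x = ENNReal.ofReal (x ^ β) := if_pos hx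

lemma posPow_of_nonpos {β x : ℝ} (hx : x ≤ 0) : posPow β x = 0 := if_neg hx.not_gt

lemma measurable_posPow (β : ℝ) : Measurable (posPow β) :=
  Measurable.ite measurableSet_Ioi (by fun_prop) measurable_const

lemma posPow_mul {β x y : ℝ} (hx : 0 < x) :
    posPow β (x * y) = ENNReal.ofReal (x ^ β) * posPow β y := by
  rcases le_or_gt y 0 with hy | hy
  · rw [posPow_of_nonpos hy, posPow_of_nonpos (mul_nonpos_of_nonneg_of_nonpos hx.le hy), mul_zero]
  · rw [posPow_of_pos hy, posPow_of_pos (by positivity), Real.mul_rpow hx.le hy.le,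
      ENNReal.ofReal_mul (by positivity)]

/-- In polar coordinates the angular integral lowers the exponent of the kernel by one, to κ = γ + 1
+ s. Since 1 - rρ dominates both 1 - r and 1 - ρ, the substitution t = 1 - ρ leaves the model
integral with δ = 1 - r. -/
theorem disk_integral_le {γ s : ℝ} (hγ : -1 < γ) (hs : 0 < s) : ∃ C : ℝ, 0 < C ∧
    ∀ r : ℝ, 0 ≤ r → r < 1 →
      ∫⁻ l : ℂ, posPow γ (1 - ‖l‖ ^ 2) * ENNReal.ofReal (‖1 - r * l‖ ^ (-(γ + 2 + s))) ≤
        ENNReal.ofReal (C * (1 - r ^ 2) ^ (-s)) := by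
  have hpi := Real.pi_pos
  set κ := γ + 1 + s with hκ
  have hκ0 : 0 < κ := by linarith
  have hγ1 : 0 < γ + 1 := by linarith
  set A := 2 * Real.pi ^ (1 + κ) * (1 + 1 / κ) with hA
  have hA0 : 0 < A := by positivity
  set D := A * 2 ^ |γ| * (1 / (γ + 1) + 1 / s) with hD
  have hD0 : 0 < D := by positivity
  refine ⟨D * 2 ^ s, by positivity, fun r h0 h1 => ?_⟩
  rw [← Complex.lintegral_comp_polarCoord_symm, polarCoord_target,
    Measure.volume_eq_prod, ← Measure.prod_restrict]
  have hr : 0 < 1 - r := by linarith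
  set G : ℝ → ℝ≥0∞ := fun t => ENNReal.ofReal (A * 2 ^ |γ|) *
    ENNReal.ofReal (t ^ γ * (max (1 - r) t) ^ (-(γ + 1 + s))) with hG
  have inner_le : ∀ ρ ∈ Ioi (0 : ℝ), ∫⁻ θ in Ioo (-Real.pi) Real.pi, ENNReal.ofReal ρ •
      (posPow γ (1 - ‖Complex.polarCoord.symm (ρ, θ)‖ ^ 2) *
        ENNReal.ofReal (‖1 - r * Complex.polarCoord.symm (ρ, θ)‖ ^ (-(γ + 2 + s)))) ≤
      (Ioi (0 : ℝ)).indicator G (1 - ρ) := by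
    intro ρ hρ
    have hρ0 : (0 : ℝ) < ρ := hρ
    have hnorm : ∀ θ : ℝ, ‖Complex.polarCoord.symm (ρ, θ)‖ = ρ := fun θ => by
      simp [hρ0.le]
    simp only [hnorm]
    rcases le_or_gt 1 ρ with h | h
    · rw [posPow_of_nonpos (by nlinarith)]
      simp
    have hp : 0 < 1 - ρ := by linarith
    rw [indicator_of_mem (show 1 - ρ ∈ Ioi (0 : ℝ) from hp), posPow_of_pos (by nlinarith)]
    have hrρ : r * ρ < 1 := by nlinarith
    have hang := lintegral_angle_le hκ0 (mul_nonneg h0 hρ0.le) hrρ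
    have e : ∀ θ : ℝ, (1 - (r : ℂ) * Complex.polarCoord.symm (ρ, θ)) =
        1 - ((r * ρ : ℝ) : ℂ) * (Real.cos θ + Real.sin θ * Complex.I) := fun θ => by
      rw [Complex.polarCoord_symm_apply]
      push_cast
      ring
    simp only [e, smul_eq_mul]
    rw [lintegral_const_mul' _ _ ENNReal.ofReal_ne_top,
      lintegral_const_mul' _ _ ENNReal.ofReal_ne_top, ← mul_assoc]
    have e2 : -(γ + 2 + s) = -(1 + κ) := by rw [hκ]; ring
    rw [e2]
    refine (mul_le_mul_right hang _).trans ?_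
    rw [hG]
    simp only
    have k0 : 0 ≤ (1 - ρ ^ 2) ^ γ := Real.rpow_nonneg (by nlinarith) _
    rw [← ENNReal.ofReal_mul hρ0.le, ← ENNReal.ofReal_mul (mul_nonneg hρ0.le k0),
      ← ENNReal.ofReal_mul (by positivity)]
    refine ENNReal.ofReal_le_ofReal ?_
    -- The factor (1 + ρ)^γ is at most 2^|γ| whatever the sign of γ.
    have k1 : (1 - ρ ^ 2) ^ γ ≤ 2 ^ |γ| * (1 - ρ) ^ γ := by
      rw [show 1 - ρ ^ 2 = (1 + ρ) * (1 - ρ) by ring, Real.mul_rpow (by linarith) hp.le]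
      gcongr
      calc (1 + ρ) ^ γ ≤ (1 + ρ) ^ |γ| :=
            Real.rpow_le_rpow_of_exponent_le (by linarith) (le_abs_self γ)
        _ ≤ 2 ^ |γ| := Real.rpow_le_rpow (by linarith) (by linarith) (abs_nonneg _)
    have k2 : (1 - r * ρ) ^ (-κ) ≤ (max (1 - r) (1 - ρ)) ^ (-κ) :=
      Real.rpow_le_rpow_of_nonpos (lt_max_of_lt_left hr)
        (max_le (by nlinarith) (by nlinarith)) (by linarith)
    have k3 : 0 ≤ (1 - ρ ^ 2) ^ γ := Real.rpow_nonneg (by nlinarith) _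
    have k4 : 0 ≤ (1 - r * ρ) ^ (-κ) := Real.rpow_nonneg (by nlinarith) _
    calc ρ * (1 - ρ ^ 2) ^ γ * (A * (1 - r * ρ) ^ (-κ))
        ≤ 1 * (2 ^ |γ| * (1 - ρ) ^ γ) * (A * (max (1 - r) (1 - ρ)) ^ (-κ)) := by gcongr
      _ = _ := by ring
  calc _ ≤ ∫⁻ ρ in Ioi (0 : ℝ), ∫⁻ θ in Ioo (-Real.pi) Real.pi, ENNReal.ofReal ρ •
      (posPow γ (1 - ‖Complex.polarCoord.symm (ρ, θ)‖ ^ 2) *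
        ENNReal.ofReal (‖1 - r * Complex.polarCoord.symm (ρ, θ)‖ ^ (-(γ + 2 + s)))) :=
        lintegral_prod_le _
    _ ≤ ∫⁻ ρ in Ioi (0 : ℝ), (Ioi (0 : ℝ)).indicator G (1 - ρ) :=
        setLIntegral_mono' measurableSet_Ioi inner_le
    _ ≤ ∫⁻ ρ, (Ioi (0 : ℝ)).indicator G (1 - ρ) := setLIntegral_le_lintegral _ _
    _ = ∫⁻ t in Ioi (0 : ℝ), G t := by
        rw [lintegral_sub_left_eq_self (fun t => (Ioi (0 : ℝ)).indicator G t) 1,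
          lintegral_indicator measurableSet_Ioi]
    _ ≤ ENNReal.ofReal (D * (1 - r) ^ (-s)) := by
        have e : D * (1 - r) ^ (-s) = A * 2 ^ |γ| * ((1 / (γ + 1) + 1 / s) * (1 - r) ^ (-s)) := by
          rw [hD]; ring
        rw [hG, lintegral_const_mul' _ _ ENNReal.ofReal_ne_top, e,
          ENNReal.ofReal_mul (p := A * 2 ^ |γ|) (by positivity)]
        exact mul_le_mul_right (lintegral_rpow_mul_max_le hγ hs hr) _
    _ ≤ _ := by
        refine ENNReal.ofReal_le_ofReal ?_
        rw [mul_assoc D (2 ^ s)]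
        refine mul_le_mul_of_nonneg_left ?_ hD0.le
        have : (1 - r) ^ (-s) ≤ ((1 - r ^ 2) / 2) ^ (-s) :=
          Real.rpow_le_rpow_of_nonpos (by nlinarith) (by nlinarith) (by linarith)
        refine this.trans (le_of_eq ?_)
        rw [Real.div_rpow (by nlinarith) (by norm_num), Real.rpow_neg (by norm_num : (0:ℝ) ≤ 2),
          div_inv_eq_mul, mul_comm]

end ForelliRudin

/-! ### Reduction from the ball to the disc by slicing -/

section Slicing

lemma finrank_real_Cn (n : ℕ) : Module.finrank ℝ (Cn n) = 2 * n := by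
  rw [← Module.finrank_mul_finrank ℝ ℂ (Cn n), Complex.finrank_real_complex,
    finrank_euclideanSpace_fin]

/-- The mass `∫ (1 - |η|²)^β dη` of the unit ball. -/
def ballMass (n : ℕ) (β : ℝ) : ℝ≥0∞ := ∫⁻ η : Cn n, posPow β (1 - ‖η‖ ^ 2)

/-- Scale by √x in real dimension 2n. The extension of the power by zero makes both sides vanish for
x ≤ 0, so the formula applies to every slice. -/
lemma lintegral_posPow_sub (n : ℕ) (β x : ℝ) :
    ∫⁻ η : Cn n, posPow β (x - ‖η‖ ^ 2) = posPow (β + n) x * ballMass n β := by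
  rcases le_or_gt x 0 with hx | hx
  · rw [posPow_of_nonpos hx, zero_mul]
    refine (lintegral_congr fun η => ?_).trans lintegral_zero
    exact posPow_of_nonpos (by nlinarith [sq_nonneg ‖η‖])
  have ht : 0 < Real.sqrt x := Real.sqrt_pos.2 hx
  have hsq : Real.sqrt x ^ 2 = x := Real.sq_sqrt hx.le
  have hm : Measurable fun η : Cn n => posPow β (x - ‖η‖ ^ 2) :=
    (measurable_posPow β).comp (by fun_prop)
  have h1 : ∫⁻ η : Cn n, posPow β (x - ‖Real.sqrt x • η‖ ^ 2) =
      ENNReal.ofReal (x ^ β) * ballMass n β := by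
    rw [ballMass, ← lintegral_const_mul' _ _ ENNReal.ofReal_ne_top]
    refine lintegral_congr fun η => ?_
    rw [← posPow_mul hx, norm_smul, mul_pow, Real.norm_of_nonneg ht.le, hsq, mul_one_sub]
  have h2 : ∫⁻ η : Cn n, posPow β (x - ‖Real.sqrt x • η‖ ^ 2) =
      ENNReal.ofReal (x ^ n)⁻¹ * ∫⁻ η : Cn n, posPow β (x - ‖η‖ ^ 2) := by
    have hmap := Measure.map_addHaar_smul (volume : Measure (Cn n)) ht.ne'
    rw [← lintegral_map (f := fun η : Cn n => posPow β (x - ‖η‖ ^ 2))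
      (g := fun η : Cn n => Real.sqrt x • η) hm (measurable_const_smul _), hmap,
      lintegral_smul_measure, finrank_real_Cn, pow_mul, hsq, abs_of_pos (by positivity),
      smul_eq_mul]
  have hxn : ENNReal.ofReal (x ^ n) * ENNReal.ofReal (x ^ n)⁻¹ = 1 := by
    rw [← ENNReal.ofReal_mul (by positivity), mul_inv_cancel₀ (by positivity), ENNReal.ofReal_one]
  calc _ = ENNReal.ofReal (x ^ n) * (ENNReal.ofReal (x ^ n)⁻¹ *
        ∫⁻ η : Cn n, posPow β (x - ‖η‖ ^ 2)) := by rw [← mul_assoc, hxn, one_mul]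
    _ = _ := by
      rw [← h2, h1, ← mul_assoc, ← ENNReal.ofReal_mul (by positivity), posPow_of_pos hx,
        Real.rpow_add hx, Real.rpow_natCast, mul_comm (x ^ n)]

lemma exists_orthonormalBasis_zero_eq {G : Type*} [NormedAddCommGroup G] [InnerProductSpace ℂ G]
    [FiniteDimensional ℂ G] {m : ℕ} (hG : Module.finrank ℂ G = m + 1) {g : G} (hg : ‖g‖ = 1) :
    ∃ b : OrthonormalBasis (Fin (m + 1)) ℂ G, b 0 = g := by
  have ho : Orthonormal ℂ (({0} : Set (Fin (m + 1))).domRestrict fun _ => g) := by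
    rw [orthonormal_iff_ite]
    rintro ⟨i, rfl⟩ ⟨j, rfl⟩
    simp [inner_self_eq_norm_sq_to_K, hg]
  obtain ⟨b, hb⟩ := ho.exists_orthonormalBasis_extension_of_card_eq (by simp [hG])
  exact ⟨b, hb 0 rfl⟩

lemma exists_linearIsometryEquiv_apply_eq {E F : Type*} [NormedAddCommGroup E]
    [InnerProductSpace ℂ E] [FiniteDimensional ℂ E] [NormedAddCommGroup F] [InnerProductSpace ℂ F]
    [FiniteDimensional ℂ F] {m : ℕ} (hE : Module.finrank ℂ E = m + 1)
    (hF : Module.finrank ℂ F = m + 1) {u : E} {v : F} (hu : ‖u‖ = 1) (hv : ‖v‖ = 1) :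
    ∃ e : E ≃ₗᵢ[ℂ] F, e u = v := by
  obtain ⟨b, hb⟩ := exists_orthonormalBasis_zero_eq hE hu
  obtain ⟨b', hb'⟩ := exists_orthonormalBasis_zero_eq hF hv
  refine ⟨b.repr.trans b'.repr.symm, ?_⟩
  rw [← hb, ← hb']
  simp

lemma exists_rotation {m : ℕ} (z : Cn (m + 1)) :
    ∃ e : Cn (m + 1) ≃ₗᵢ[ℂ] WithLp 2 (ℂ × Cn m), e z = WithLp.toLp 2 ((‖z‖ : ℂ), 0) := by
  have hF : Module.finrank ℂ (WithLp 2 (ℂ × Cn m)) = m + 1 := by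
    rw [(WithLp.linearEquiv 2 ℂ (ℂ × Cn m)).finrank_eq, Module.finrank_prod]
    simp [add_comm]
  have hv : ‖(WithLp.toLp 2 ((1 : ℂ), (0 : Cn m)))‖ = 1 := by
    simp
  rcases eq_or_ne z 0 with rfl | hz
  · obtain ⟨e, -⟩ := exists_linearIsometryEquiv_apply_eq (E := Cn (m + 1)) (m := m) (by simp) hF
      (u := EuclideanSpace.single 0 1) (by simp) hv
    refine ⟨e, ?_⟩
    rw [map_zero, norm_zero, Complex.ofReal_zero]
    rfl
  · have hz' : (‖z‖ : ℂ) ≠ 0 := by simpa using hz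
    obtain ⟨e, he⟩ := exists_linearIsometryEquiv_apply_eq (E := Cn (m + 1)) (m := m) (by simp) hF
      (u := (‖z‖ : ℂ)⁻¹ • z) (by simp [norm_smul, hz]) hv
    refine ⟨e, ?_⟩
    have : z = (‖z‖ : ℂ) • ((‖z‖ : ℂ)⁻¹ • z) := by rw [smul_smul, mul_inv_cancel₀ hz', one_smul]
    conv_lhs => rw [this, map_smul, he]
    refine (WithLp.equiv 2 (ℂ × Cn m)).injective ?_
    simp

/-- Rotate z onto the first axis; then F sees only the first coordinate l. The slice over l is a
ball of radius √(1 - |l|²) in the other m coordinates, and integrating over it raises the exponent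
of the weight by m. -/
lemma lintegral_posPow_mul_inner {m : ℕ} (β : ℝ) {F : ℂ → ℝ≥0∞} (hF : Measurable F)
    (z : Cn (m + 1)) :
    ∫⁻ w : Cn (m + 1), posPow β (1 - ‖w‖ ^ 2) * F (inner ℂ z w) =
      ballMass m β * ∫⁻ l : ℂ, posPow (β + m) (1 - ‖l‖ ^ 2) * F (‖z‖ * l) := by
  obtain ⟨e, he⟩ := exists_rotation z
  let e' : Cn (m + 1) ≃ₗᵢ[ℝ] WithLp 2 (ℂ × Cn m) :=
    ⟨e.toLinearEquiv.restrictScalars ℝ, e.norm_map⟩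
  have hmp : MeasurePreserving (fun w => e w) (volume : Measure (Cn (m + 1)))
      (volume : Measure (WithLp 2 (ℂ × Cn m))) := e'.measurePreserving
  have hm1 : Measurable fun y : WithLp 2 (ℂ × Cn m) => posPow β (1 - ‖y‖ ^ 2) *
      F (inner ℂ (e z) y) :=
    ((measurable_posPow β).comp (by fun_prop)).mul (hF.comp (by fun_prop))
  have h1 : ∫⁻ w : Cn (m + 1), posPow β (1 - ‖w‖ ^ 2) * F (inner ℂ z w) =
      ∫⁻ y : WithLp 2 (ℂ × Cn m), posPow β (1 - ‖y‖ ^ 2) * F (inner ℂ (e z) y) := by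
    rw [← hmp.lintegral_comp hm1]
    simp
  have h2 : ∀ q : ℂ × Cn m, posPow β (1 - ‖WithLp.toLp 2 q‖ ^ 2) *
      F (inner ℂ (e z) (WithLp.toLp 2 q)) =
      posPow β (1 - ‖q.1‖ ^ 2 - ‖q.2‖ ^ 2) * F (‖z‖ * q.1) := by
    intro q
    rw [he, WithLp.prod_norm_sq_eq_of_L2, WithLp.prod_inner_apply, sub_sub]
    simp [mul_comm]
  rw [h1, ← (WithLp.volume_preserving_toLp ℂ (Cn m)).lintegral_comp hm1]
  simp only [h2]
  have hm2 : Measurable fun q : ℂ × Cn m =>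
      posPow β (1 - ‖q.1‖ ^ 2 - ‖q.2‖ ^ 2) * F (‖z‖ * q.1) :=
    ((measurable_posPow β).comp (by fun_prop)).mul (hF.comp (by fun_prop))
  rw [Measure.volume_eq_prod, lintegral_prod _ hm2.aemeasurable, ← lintegral_const_mul]
  · refine lintegral_congr fun l => ?_
    simp only
    have hm3 : Measurable fun y : Cn m => posPow β (1 - ‖l‖ ^ 2 - ‖y‖ ^ 2) :=
      (measurable_posPow β).comp (by fun_prop)
    rw [lintegral_mul_const _ hm3, lintegral_posPow_sub]
    ring
  · exact ((measurable_posPow _).comp (by fun_prop)).mul (hF.comp (by fun_prop))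

/-- Induction on the dimension by slicing with F = 1. The disc factor is finite by
`disk_integral_le` at r = 0, where the kernel is 1. -/
lemma ballMass_lt_top (n : ℕ) {β : ℝ} (hβ : -1 < β) : ballMass n β < ∞ := by
  induction n with
  | zero =>
    have h1 : ∀ η : Cn 0, posPow β (1 - ‖η‖ ^ 2) = 1 := fun η => by
      rw [Subsingleton.elim η 0]
      simp [posPow]
    have h2 : (univ : Set (Cn 0)) = Metric.ball 0 1 :=
      (eq_univ_of_forall fun η => by rw [Subsingleton.elim η 0]; simp).symm
    simp only [ballMass, h1, lintegral_const, one_mul, h2]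
    exact Metric.isBounded_ball.measure_lt_top
  | succ m ih =>
    have h := lintegral_posPow_mul_inner (m := m) β (F := fun _ => 1) measurable_const 0
    simp only [mul_one] at h
    rw [ballMass, h]
    refine ENNReal.mul_lt_top ih ?_
    obtain ⟨C, -, hC⟩ := disk_integral_le (γ := β + m) (s := 1)
      (by linarith [(Nat.cast_nonneg m : (0 : ℝ) ≤ m)]) one_pos
    have := hC 0 le_rfl one_pos
    simp only [Complex.ofReal_zero, zero_mul, sub_zero, norm_one, Real.one_rpow,
      ENNReal.ofReal_one, mul_one] at this
    exact this.trans_lt ENNReal.ofReal_lt_top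

/-- Slicing with n = m + 1 reduces this to the disc with γ = α - s + m, for which γ + 2 + s is
exactly n + 1 + α. The upper bound on s makes the mass of the slices finite. -/
theorem forelli_rudin {n : ℕ} (hn : 1 ≤ n) {α s : ℝ} (hs : 0 < s) (hsα : s < α + 1) :
    ∃ C : ℝ, 0 < C ∧ ∀ z ∈ unitBall n,
      ∫⁻ w in unitBall n, ENNReal.ofReal ((1 - ‖w‖ ^ 2) ^ (α - s)) *
        ENNReal.ofReal (‖1 - inner ℂ z w‖ ^ (-((n : ℝ) + 1 + α))) ≤
      ENNReal.ofReal (C * (1 - ‖z‖ ^ 2) ^ (-s)) := by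
  obtain ⟨m, rfl⟩ := Nat.exists_eq_add_of_le' hn
  obtain ⟨C, hC0, hC⟩ := disk_integral_le (γ := α - s + m) (s := s)
    (by linarith [(Nat.cast_nonneg m : (0 : ℝ) ≤ m)]) hs
  have hM := ballMass_lt_top m (β := α - s) (by linarith)
  -- The summand 1 only makes the constant visibly positive.
  refine ⟨((ballMass m (α - s)).toReal + 1) * C, by positivity, fun z hz => ?_⟩
  have h1 : ∫⁻ w in unitBall (m + 1), ENNReal.ofReal ((1 - ‖w‖ ^ 2) ^ (α - s)) *
        ENNReal.ofReal (‖1 - inner ℂ z w‖ ^ (-(((m + 1 : ℕ) : ℝ) + 1 + α))) ≤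
      ∫⁻ w, posPow (α - s) (1 - ‖w‖ ^ 2) *
        ENNReal.ofReal (‖1 - inner ℂ z w‖ ^ (-(((m + 1 : ℕ) : ℝ) + 1 + α))) := by
    rw [← lintegral_indicator measurableSet_unitBall]
    refine lintegral_mono fun w => ?_
    by_cases hw : w ∈ unitBall (m + 1)
    · rw [indicator_of_mem hw, posPow_of_pos (one_sub_norm_sq_pos hw)]
    · simp [indicator_of_notMem hw]
  refine h1.trans ?_
  have hF : Measurable fun x : ℂ =>
      ENNReal.ofReal (‖1 - x‖ ^ (-(((m + 1 : ℕ) : ℝ) + 1 + α))) := by fun_prop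
  rw [lintegral_posPow_mul_inner (α - s) hF z]
  have h2 := hC ‖z‖ (norm_nonneg z) (mem_unitBall.1 hz)
  have e : -(α - s + m + 2 + s) = -(((m + 1 : ℕ) : ℝ) + 1 + α) := by push_cast; ring
  rw [e] at h2
  refine (mul_le_mul_right h2 _).trans ?_
  rw [mul_assoc, ENNReal.ofReal_mul (p := (ballMass m (α - s)).toReal + 1) (by positivity)]
  refine mul_le_mul_left ?_ _
  calc ballMass m (α - s) = ENNReal.ofReal (ballMass m (α - s)).toReal :=
        (ENNReal.ofReal_toReal hM.ne).symm
    _ ≤ _ := ENNReal.ofReal_le_ofReal (by linarith)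

end Slicing

/-! ### Schur's test -/

section SchurTest

/-- Hölder applied to k g = (k^(1/p) h⁻¹ g)(k^(1/q) h) uses the first test inequality. Tonelli and
the symmetry of k then bring in the second one, and the powers of h cancel. -/
theorem schur_test {X : Type*} [MeasurableSpace X] {μ : Measure X} [SFinite μ] {p q : ℝ}
    (hpq : p.HolderConjugate q) {k : X → X → ℝ≥0∞} (hk : Measurable (Function.uncurry k))
    (hsymm : ∀ x y, k x y = k y x) {h : X → ℝ≥0∞} (hh : Measurable h)
    (h0 : ∀ᵐ x ∂μ, h x ≠ 0) (htop : ∀ᵐ x ∂μ, h x ≠ ∞) {A B : ℝ≥0∞}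
    (hA : ∀ᵐ x ∂μ, ∫⁻ y, k x y * h y ^ q ∂μ ≤ A * h x ^ q)
    (hB : ∀ᵐ x ∂μ, ∫⁻ y, k x y * h y ^ p ∂μ ≤ B * h x ^ p)
    {g : X → ℝ≥0∞} (hg : Measurable g) :
    ∫⁻ x, (∫⁻ y, k x y * g y ∂μ) ^ p ∂μ ≤ A ^ (p / q) * B * ∫⁻ x, g x ^ p ∂μ := by
  have hp0 := hpq.pos
  have hq0 := hpq.symm.pos
  have hk1 : ∀ x, Measurable (k x) := fun x => hk.comp measurable_prodMk_left
  have pointwise : ∀ᵐ x ∂μ, (∫⁻ y, k x y * g y ∂μ) ^ p ≤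
      A ^ (p / q) * h x ^ p * ∫⁻ y, k x y * ((h y)⁻¹ * g y) ^ p ∂μ := by
    filter_upwards [hA] with x hx
    have e1 : ∫⁻ y, k x y * g y ∂μ = ∫⁻ y, ((fun y => k x y ^ (1 / p) * ((h y)⁻¹ * g y)) *
        (fun y => k x y ^ (1 / q) * h y)) y ∂μ := by
      refine lintegral_congr_ae ?_
      filter_upwards [h0, htop] with y hy0 hyt
      have hkk : k x y = k x y ^ (1 / p) * k x y ^ (1 / q) := by
        rw [← ENNReal.rpow_add_of_nonneg _ _ (by positivity) (by positivity), one_div, one_div,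
          hpq.inv_add_inv_eq_one, ENNReal.rpow_one]
      calc k x y * g y = k x y * g y * ((h y)⁻¹ * h y) := by
            rw [ENNReal.inv_mul_cancel hy0 hyt, mul_one]
        _ = (k x y ^ (1 / p) * k x y ^ (1 / q)) * g y * ((h y)⁻¹ * h y) := by rw [← hkk]
        _ = _ := by simp only [Pi.mul_apply]; ring
    have e2 : ∀ y, (k x y ^ (1 / p) * ((h y)⁻¹ * g y)) ^ p = k x y * ((h y)⁻¹ * g y) ^ p :=
      fun y => by
        rw [ENNReal.mul_rpow_of_nonneg _ _ hp0.le, ← ENNReal.rpow_mul, one_div_mul_cancel hp0.ne',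
          ENNReal.rpow_one]
    have e3 : ∀ y, (k x y ^ (1 / q) * h y) ^ q = k x y * h y ^ q :=
      fun y => by
        rw [ENNReal.mul_rpow_of_nonneg _ _ hq0.le, ← ENNReal.rpow_mul, one_div_mul_cancel hq0.ne',
          ENNReal.rpow_one]
    have hold := ENNReal.lintegral_mul_le_Lp_mul_Lq μ hpq
      (f := fun y => k x y ^ (1 / p) * ((h y)⁻¹ * g y)) (g := fun y => k x y ^ (1 / q) * h y)
      (((hk1 x).pow_const _).mul (hh.inv.mul hg)).aemeasurable
      (((hk1 x).pow_const _).mul hh).aemeasurable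
    rw [← e1] at hold
    simp only [e2, e3] at hold
    calc (∫⁻ y, k x y * g y ∂μ) ^ p
        ≤ ((∫⁻ y, k x y * ((h y)⁻¹ * g y) ^ p ∂μ) ^ (1 / p) *
            (∫⁻ y, k x y * h y ^ q ∂μ) ^ (1 / q)) ^ p := by gcongr
      _ ≤ ((∫⁻ y, k x y * ((h y)⁻¹ * g y) ^ p ∂μ) ^ (1 / p) * (A * h x ^ q) ^ (1 / q)) ^ p := by
          gcongr
      _ = _ := by
          rw [ENNReal.mul_rpow_of_nonneg _ _ hp0.le, ← ENNReal.rpow_mul,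
            one_div_mul_cancel hp0.ne', ENNReal.rpow_one,
            ENNReal.mul_rpow_of_nonneg _ _ (by positivity : (0 : ℝ) ≤ 1 / q), ← ENNReal.rpow_mul,
            mul_one_div_cancel hq0.ne', ENNReal.rpow_one,
            ENNReal.mul_rpow_of_nonneg _ _ hp0.le, ← ENNReal.rpow_mul, one_div_mul_eq_div, mul_comm]
  have hm : Measurable fun y => ((h y)⁻¹ * g y) ^ p := (hh.inv.mul hg).pow_const _
  calc _ ≤ ∫⁻ x, A ^ (p / q) * h x ^ p * ∫⁻ y, k x y * ((h y)⁻¹ * g y) ^ p ∂μ ∂μ :=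
        lintegral_mono_ae pointwise
    _ = A ^ (p / q) * ∫⁻ x, ∫⁻ y, h x ^ p * (k x y * ((h y)⁻¹ * g y) ^ p) ∂μ ∂μ := by
        rw [← lintegral_const_mul]
        · refine lintegral_congr fun x => ?_
          have hm1 : Measurable fun y => k x y * ((h y)⁻¹ * g y) ^ p := (hk1 x).mul hm
          rw [lintegral_const_mul _ hm1, mul_assoc]
        · refine Measurable.lintegral_prod_right' (f := fun z : X × X =>
            h z.1 ^ p * (k z.1 z.2 * ((h z.2)⁻¹ * g z.2) ^ p)) ?_
          exact ((hh.comp measurable_fst).pow_const _).mul (hk.mul (hm.comp measurable_snd))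
    _ = A ^ (p / q) * ∫⁻ y, ((h y)⁻¹ * g y) ^ p * ∫⁻ x, k y x * h x ^ p ∂μ ∂μ := by
        rw [lintegral_lintegral_swap]
        · congr 1
          refine lintegral_congr fun y => ?_
          have hm1 : Measurable fun x => k y x * h x ^ p := (hk1 y).mul (hh.pow_const _)
          rw [← lintegral_const_mul _ hm1]
          refine lintegral_congr fun x => ?_
          rw [hsymm x y]
          ring
        · exact (((hh.comp measurable_fst).pow_const _).mul
            (hk.mul (hm.comp measurable_snd))).aemeasurable
    _ ≤ A ^ (p / q) * ∫⁻ y, ((h y)⁻¹ * g y) ^ p * (B * h y ^ p) ∂μ := by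
        gcongr 1
        refine lintegral_mono_ae ?_
        filter_upwards [hB] with y hy
        gcongr
    _ = A ^ (p / q) * ∫⁻ y, B * g y ^ p ∂μ := by
        congr 1
        refine lintegral_congr_ae ?_
        filter_upwards [h0, htop] with y hy0 hyt
        rw [mul_left_comm, ← ENNReal.mul_rpow_of_nonneg _ _ hp0.le, mul_right_comm,
          ENNReal.inv_mul_cancel hy0 hyt, one_mul]
    _ = _ := by rw [lintegral_const_mul _ (hg.pow_const _), mul_assoc]

end SchurTest

/-! ### The weighted measure and the maximal Bergman projection -/

section Measures

variable {n : ℕ} {α : ℝ}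

/-- The constant relating `v_α` to the Lebesgue measure. -/
def volumeConst (n : ℕ) (α : ℝ) : ℝ≥0∞ :=
  (volume (unitBall n))⁻¹ * ENNReal.ofReal (weightConst n α)

lemma weightConst_pos (hα : -1 < α) : 0 < weightConst n α := by
  have h1 : 0 < Real.Gamma (n + α + 1) :=
    Real.Gamma_pos_of_pos (by linarith [(Nat.cast_nonneg n : (0 : ℝ) ≤ n)])
  have h2 : 0 < Real.Gamma (α + 1) := Real.Gamma_pos_of_pos (by linarith)
  have h3 : (0 : ℝ) < n.factorial := by exact_mod_cast n.factorial_pos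
  unfold weightConst
  positivity

lemma volumeConst_ne_zero (hα : -1 < α) : volumeConst n α ≠ 0 := by
  have h : volume (unitBall n) < ∞ := Metric.isBounded_ball.measure_lt_top
  simp [volumeConst, h.ne, weightConst_pos hα]

lemma volumeConst_ne_top : volumeConst n α ≠ ∞ := by
  have h : volume (unitBall n) ≠ 0 := (Metric.measure_ball_pos _ _ one_pos).ne'
  exact ENNReal.mul_ne_top (ENNReal.inv_ne_top.2 h) ENNReal.ofReal_ne_top

lemma measurable_weight (β : ℝ) :
    Measurable fun w : Cn n => ENNReal.ofReal ((1 - ‖w‖ ^ 2) ^ β) := by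
  fun_prop

lemma weightedVolume_eq (hα : -1 < α) : weightedVolume n α = volumeConst n α •
    (volume.restrict (unitBall n)).withDensity fun w => ENNReal.ofReal ((1 - ‖w‖ ^ 2) ^ α) := by
  have h : (fun z : Cn n => ENNReal.ofReal (weightConst n α * (1 - ‖z‖ ^ 2) ^ α)) =
      ENNReal.ofReal (weightConst n α) • fun z : Cn n => ENNReal.ofReal ((1 - ‖z‖ ^ 2) ^ α) := by
    ext z
    simp [ENNReal.ofReal_mul (weightConst_pos hα).le]
  rw [weightedVolume, normalizedVolume, h, withDensity_smul _ (measurable_weight α),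
    withDensity_smul_measure, smul_smul, volumeConst, mul_comm]

/-- The invariant measure `(1 - |w|²)^(-n-1-α) dv_α(w)`. -/
def invariantMeasure (n : ℕ) (α : ℝ) : Measure (Cn n) := volumeConst n α • hyperbolicVolume n

/-- Separating the density from the invariant measure lets a change of variables by φ_z act on the
density alone. -/
lemma weightedVolume_eq_withDensity (hα : -1 < α) : weightedVolume n α =
    (invariantMeasure n α).withDensity
      fun w => ENNReal.ofReal ((1 - ‖w‖ ^ 2) ^ ((n : ℝ) + 1 + α)) := by
  rw [weightedVolume_eq hα, invariantMeasure, withDensity_smul_measure, hyperbolicVolume,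
    ← withDensity_mul _ measurable_hyperbolicDensity (measurable_weight _)]
  congr 1
  refine withDensity_congr_ae ?_
  filter_upwards [ae_restrict_mem measurableSet_unitBall] with w hw
  have h := one_sub_norm_sq_pos hw
  rw [Pi.mul_apply, ← ENNReal.ofReal_mul (by positivity)]
  congr 1
  rw [Real.rpow_add h, show (n : ℝ) + 1 = ((n + 1 : ℕ) : ℝ) by push_cast; rfl, Real.rpow_natCast]
  field_simp

lemma lintegral_weightedVolume (hα : -1 < α) {g : Cn n → ℝ≥0∞} (hg : Measurable g) :
    ∫⁻ w, g w ∂(weightedVolume n α) = volumeConst n α *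
      ∫⁻ w in unitBall n, ENNReal.ofReal ((1 - ‖w‖ ^ 2) ^ α) * g w := by
  rw [weightedVolume_eq hα, lintegral_smul_measure, smul_eq_mul,
    lintegral_withDensity_eq_lintegral_mul _ (measurable_weight α) hg]
  rfl

lemma ae_mem_unitBall : ∀ᵐ w ∂(weightedVolume n α), w ∈ unitBall n := by
  refine (withDensity_absolutelyContinuous _ _).ae_le ?_
  exact Measure.ae_smul_measure (ae_restrict_mem measurableSet_unitBall) _

lemma ae_mem_unitBall_invariantMeasure : ∀ᵐ w ∂(invariantMeasure n α), w ∈ unitBall n :=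
  Measure.ae_smul_measure
    ((withDensity_absolutelyContinuous _ _).ae_le (ae_restrict_mem measurableSet_unitBall)) _

instance : SigmaFinite (hyperbolicVolume n) := by
  unfold hyperbolicVolume
  infer_instance

instance : SFinite (invariantMeasure n α) := by
  unfold invariantMeasure
  infer_instance

instance : SFinite (weightedVolume n α) := by
  unfold weightedVolume normalizedVolume
  infer_instance

lemma measurePreserving_ballAut_invariantMeasure {z : Cn n} (hz : z ∈ unitBall n) :
    MeasurePreserving (ballAut z) (invariantMeasure n α) (invariantMeasure n α) :=
  (measurePreserving_ballAut hz).smul_measure _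

/-- The modulus of the Bergman kernel. -/
def absKernel (n : ℕ) (α : ℝ) (z w : Cn n) : ℝ≥0∞ :=
  ENNReal.ofReal (‖1 - inner ℂ z w‖ ^ (-((n : ℝ) + 1 + α)))

lemma absKernel_symm (z w : Cn n) : absKernel n α z w = absKernel n α w z := by
  have h : 1 - inner ℂ w z = starRingEnd ℂ (1 - inner ℂ z w) := by simp
  rw [absKernel, absKernel, h, Complex.norm_conj]

lemma measurable_absKernel : Measurable (Function.uncurry (absKernel n α)) := by
  have : Measurable fun q : Cn n × Cn n => ‖1 - (inner ℂ q.1 q.2 : ℂ)‖ :=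
    (continuous_const.sub (continuous_fst.inner continuous_snd)).norm.measurable
  exact (this.pow_const _).ennreal_ofReal

/-- The integral operator whose kernel is the modulus of the Bergman kernel. -/
def absProjection (n : ℕ) (α : ℝ) (g : Cn n → ℝ≥0∞) (z : Cn n) : ℝ≥0∞ :=
  ∫⁻ w, absKernel n α z w * g w ∂(weightedVolume n α)

lemma measurable_absProjection {g : Cn n → ℝ≥0∞} (hg : Measurable g) :
    Measurable (absProjection n α g) :=
  Measurable.lintegral_prod_right' (f := fun q : Cn n × Cn n => absKernel n α q.1 q.2 * g q.2)
    (measurable_absKernel.mul (hg.comp measurable_snd))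

lemma absProjection_weight_le (hn : 1 ≤ n) {s : ℝ} (hs : 0 < s) (hsα : s < α + 1) :
    ∃ A : ℝ≥0∞, A ≠ ∞ ∧ ∀ z ∈ unitBall n,
      absProjection n α (fun w => ENNReal.ofReal ((1 - ‖w‖ ^ 2) ^ (-s))) z ≤
        A * ENNReal.ofReal ((1 - ‖z‖ ^ 2) ^ (-s)) := by
  obtain ⟨C, hC0, hC⟩ := forelli_rudin hn hs hsα
  refine ⟨volumeConst n α * ENNReal.ofReal C,
    ENNReal.mul_ne_top volumeConst_ne_top ENNReal.ofReal_ne_top, fun z hz => ?_⟩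
  have hm : Measurable fun w => absKernel n α z w * ENNReal.ofReal ((1 - ‖w‖ ^ 2) ^ (-s)) :=
    measurable_absKernel.of_uncurry_left.mul (measurable_weight _)
  rw [absProjection, lintegral_weightedVolume (by linarith) hm, mul_assoc, ← ENNReal.ofReal_mul hC0.le]
  gcongr
  refine le_trans (le_of_eq ?_) (hC z hz)
  refine setLIntegral_congr_fun measurableSet_unitBall fun w hw => ?_
  have h := one_sub_norm_sq_pos hw
  rw [mul_left_comm, ← ENNReal.ofReal_mul (by positivity), ← Real.rpow_add h, ← sub_eq_add_neg,
    absKernel, mul_comm]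

/-- The maximal Bergman projection is bounded on `L^p`. -/
theorem absProjection_rpow_le (hn : 1 ≤ n) (hα : -1 < α) {p : ℝ} (hp : 1 < p) :
    ∃ C : ℝ≥0∞, C ≠ ∞ ∧ ∀ g : Cn n → ℝ≥0∞, Measurable g →
      ∫⁻ z, absProjection n α g z ^ p ∂(weightedVolume n α) ≤
        C * ∫⁻ z, g z ^ p ∂(weightedVolume n α) := by
  have hpq := Real.HolderConjugate.conjExponent hp
  set q := p.conjExponent with hq
  have hp0 := hpq.pos
  have hq0 := hpq.symm.pos
  have hq1 := hpq.symm.lt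
  have ha : 0 < α + 1 := by linarith
  obtain ⟨A, hA, hA'⟩ := absProjection_weight_le (n := n) (α := α) hn (s := (α + 1) / p)
    (by positivity) (div_lt_self ha hp)
  obtain ⟨B, hB, hB'⟩ := absProjection_weight_le (n := n) (α := α) hn (s := (α + 1) / q)
    (by positivity) (div_lt_self ha hq1)
  -- The Schur weight is h = (1 - |w|²)^(-σ). Then h^q and h^p have exponents -(α+1)/p and -(α+1)/q;
  -- as p, q > 1, both lie in the range that `forelli_rudin` allows.
  set σ := (α + 1) / (p * q) with hσ
  have e : ∀ t : ℝ, 0 < t → ∀ w ∈ unitBall n,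
      ENNReal.ofReal ((1 - ‖w‖ ^ 2) ^ (-σ)) ^ t = ENNReal.ofReal ((1 - ‖w‖ ^ 2) ^ (-(σ * t))) := by
    intro t ht w hw
    have h := one_sub_norm_sq_pos hw
    rw [ENNReal.ofReal_rpow_of_nonneg (by positivity) ht.le, ← Real.rpow_mul h.le, neg_mul]
  have step : ∀ t s : ℝ, 0 < t → σ * t = s → ∀ D : ℝ≥0∞,
      (∀ z ∈ unitBall n, absProjection n α (fun w => ENNReal.ofReal ((1 - ‖w‖ ^ 2) ^ (-s))) z ≤
        D * ENNReal.ofReal ((1 - ‖z‖ ^ 2) ^ (-s))) →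
      ∀ᵐ z ∂(weightedVolume n α), ∫⁻ w, absKernel n α z w *
        ENNReal.ofReal ((1 - ‖w‖ ^ 2) ^ (-σ)) ^ t ∂(weightedVolume n α) ≤
        D * ENNReal.ofReal ((1 - ‖z‖ ^ 2) ^ (-σ)) ^ t := by
    rintro t s ht rfl D hD
    filter_upwards [ae_mem_unitBall] with z hz
    rw [e t ht z hz]
    refine le_trans (le_of_eq (lintegral_congr_ae ?_)) (hD z hz)
    filter_upwards [ae_mem_unitBall] with w hw
    rw [e t ht w hw]
  refine ⟨A ^ (p / q) * B,
    ENNReal.mul_ne_top (ENNReal.rpow_ne_top_of_nonneg (by positivity) hA) hB, fun g hg => ?_⟩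
  refine schur_test hpq measurable_absKernel absKernel_symm (measurable_weight (-σ)) ?_
    (Filter.Eventually.of_forall fun _ => ENNReal.ofReal_ne_top)
    (step q _ hq0 (by rw [hσ]; field_simp) A hA') (step p _ hp0 (by rw [hσ]; field_simp) B hB') hg
  filter_upwards [ae_mem_unitBall] with w hw
  have := one_sub_norm_sq_pos hw
  rw [Ne, ENNReal.ofReal_eq_zero, not_le]
  positivity

lemma isFiniteMeasure_weightedVolume (hα : -1 < α) : IsFiniteMeasure (weightedVolume n α) := by
  constructor
  rw [← lintegral_one, lintegral_weightedVolume hα measurable_const]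
  refine ENNReal.mul_lt_top volumeConst_ne_top.lt_top (lt_of_le_of_lt ?_ (ballMass_lt_top n hα))
  rw [ballMass, ← lintegral_indicator measurableSet_unitBall]
  refine lintegral_mono fun w => ?_
  by_cases hw : w ∈ unitBall n
  · simp [indicator_of_mem hw, posPow_of_pos (one_sub_norm_sq_pos hw)]
  · simp [indicator_of_notMem hw]

/-- The value of the total mass is never needed: it is carried as a constant through the reproducing
formula, and only its being finite and nonzero matters. -/
lemma weightedVolume_univ_ne_zero (hα : -1 < α) : weightedVolume n α univ ≠ 0 := by
  rw [← lintegral_one, lintegral_weightedVolume hα measurable_const]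
  refine mul_ne_zero (volumeConst_ne_zero hα) ?_
  rw [Ne, lintegral_eq_zero_iff (by fun_prop)]
  intro h
  have h1 : volume (unitBall n) = 0 := by
    have h2 : ∀ᵐ w ∂volume.restrict (unitBall n), False := by
      filter_upwards [h, ae_restrict_mem measurableSet_unitBall] with w hw hwB
      have := one_sub_norm_sq_pos hwB
      simp only [mul_one, Pi.zero_apply, ENNReal.ofReal_eq_zero] at hw
      exact hw.not_gt (by positivity)
    simpa [Filter.eventually_false_iff_eq_bot] using h2
  exact (Metric.measure_ball_pos volume (0 : Cn n) one_pos).ne' h1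

end Measures

/-! ### The Bergman kernel and holomorphy of the projection -/

section Kernel

variable {n : ℕ} {α : ℝ}

/-- The Bergman kernel `(1 - z w̄)^(-n-1-α)`. -/
def bergmanKernel (n : ℕ) (α : ℝ) (z w : Cn n) : ℂ :=
  ((1 - inner ℂ w z) ^ ((n : ℂ) + 1 + (α : ℂ)))⁻¹

lemma bergmanProjection_eq (g : Cn n → ℂ) (z : Cn n) :
    bergmanProjection n α g z = ∫ w, g w * bergmanKernel n α z w ∂(weightedVolume n α) := rfl

lemma exponent_eq : (n : ℂ) + 1 + (α : ℂ) = (((n : ℝ) + 1 + α : ℝ) : ℂ) := by push_cast; rfl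

lemma exponent_pos (hα : -1 < α) : 0 < (n : ℝ) + 1 + α := by
  linarith [(Nat.cast_nonneg n : (0 : ℝ) ≤ n)]

lemma enorm_bergmanKernel (z w : Cn n) : ‖bergmanKernel n α z w‖ₑ = absKernel n α z w := by
  rw [absKernel_symm, absKernel, ← ofReal_norm, bergmanKernel, norm_inv, exponent_eq,
    Complex.norm_cpow_real, Real.rpow_neg (norm_nonneg _)]

lemma measurable_bergmanKernel : Measurable (Function.uncurry (bergmanKernel n α)) := by
  have : Measurable fun q : Cn n × Cn n => 1 - (inner ℂ q.2 q.1 : ℂ) :=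
    (continuous_const.sub (continuous_snd.inner continuous_fst)).measurable
  exact (this.pow_const _).inv

lemma one_sub_inner_mem_slitPlane {z w : Cn n} (hz : z ∈ unitBall n) (hw : w ∈ unitBall n) :
    1 - inner ℂ z w ∈ Complex.slitPlane := Or.inl (re_one_sub_inner_pos hz hw)

lemma one_sub_norm_le_norm_one_sub_inner {z w : Cn n} (hw : w ∈ unitBall n) :
    1 - ‖z‖ ≤ ‖1 - inner ℂ w z‖ := by
  have h1 : ‖inner ℂ w z‖ ≤ ‖w‖ * ‖z‖ := norm_inner_le_norm w z
  have h2 := norm_sub_norm_le (1 : ℂ) (inner ℂ w z)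
  rw [mem_unitBall] at hw
  rw [norm_one] at h2
  nlinarith [norm_nonneg z]

lemma norm_bergmanKernel (z w : Cn n) :
    ‖bergmanKernel n α z w‖ = ‖1 - inner ℂ w z‖ ^ (-((n : ℝ) + 1 + α)) := by
  rw [bergmanKernel, norm_inv, exponent_eq, Complex.norm_cpow_real, Real.rpow_neg (norm_nonneg _)]

lemma norm_bergmanKernel_le (hα : -1 < α) {z w : Cn n} (hz : z ∈ unitBall n)
    (hw : w ∈ unitBall n) :
    ‖bergmanKernel n α z w‖ ≤ (1 - ‖z‖) ^ (-((n : ℝ) + 1 + α)) := by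
  rw [norm_bergmanKernel]
  refine Real.rpow_le_rpow_of_nonpos ?_ (one_sub_norm_le_norm_one_sub_inner hw)
    (by linarith [exponent_pos (n := n) hα])
  rw [mem_unitBall] at hz
  linarith

lemma integrable_mul_bergmanKernel (hα : -1 < α) {g : Cn n → ℂ}
    (hg : Integrable g (weightedVolume n α)) {z : Cn n} (hz : z ∈ unitBall n) :
    Integrable (fun w => g w * bergmanKernel n α z w) (weightedVolume n α) := by
  refine hg.mul_bdd (c := (1 - ‖z‖) ^ (-((n : ℝ) + 1 + α)))
    (measurable_bergmanKernel.of_uncurry_left).aestronglyMeasurable ?_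
  filter_upwards [ae_mem_unitBall] with w hw
  exact norm_bergmanKernel_le hα hz hw

/-- Differentiation under the integral sign: for z in a small ball around a point, the kernel and
its derivative are bounded uniformly in w, so |g| times a constant dominates. -/
theorem differentiableOn_bergmanProjection (hα : -1 < α) {g : Cn n → ℂ}
    (hg : Integrable g (weightedVolume n α)) :
    DifferentiableOn ℂ (bergmanProjection n α g) (unitBall n) := by
  intro z₀ hz₀
  refine DifferentiableAt.differentiableWithinAt ?_
  have hc := exponent_pos (n := n) hα
  set c : ℝ := (n : ℝ) + 1 + α with hcdef
  have hz₀' := mem_unitBall.1 hz₀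
  -- Half the distance to the sphere: on the ball of radius r around z₀ one has |z| ≤ 1 - r, hence
  -- |1 - z w̄| ≥ r for all w in the unit ball.
  set r := (1 - ‖z₀‖) / 2 with hr
  have hr0 : 0 < r := by rw [hr]; linarith
  have hball : ∀ z ∈ Metric.ball z₀ r, ‖z‖ ≤ 1 - r := by
    intro z hz
    have h1 : ‖z - z₀‖ < r := by simpa [dist_eq_norm] using hz
    have h2 : ‖z‖ ≤ ‖z - z₀‖ + ‖z₀‖ := by simpa using norm_add_le (z - z₀) z₀
    linarith
  let F' : Cn n → Cn n → Cn n →L[ℂ] ℂ := fun z w =>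
    (g w * ((c : ℂ) * (1 - inner ℂ w z) ^ (-(c : ℂ) - 1))) • innerSL ℂ w
  have hF'm : AEStronglyMeasurable (F' z₀) (weightedVolume n α) := by
    have h1 : Measurable fun w : Cn n => (c : ℂ) * (1 - inner ℂ w z₀ : ℂ) ^ (-(c : ℂ) - 1) := by
      have : Measurable fun w : Cn n => (1 - inner ℂ w z₀ : ℂ) :=
        (continuous_const.sub (continuous_id.inner continuous_const)).measurable
      exact (this.pow_const _).const_mul _
    exact (hg.aestronglyMeasurable.mul h1.aestronglyMeasurable).smul
      (innerSL ℂ).continuous.aestronglyMeasurable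
  have key := hasFDerivAt_integral_of_dominated_of_fderiv_le (𝕜 := ℂ) (μ := weightedVolume n α)
    (F := fun z w => g w * bergmanKernel n α z w) (F' := F') (x₀ := z₀)
    (bound := fun w => ‖g w‖ * (c * r ^ (-c - 1))) (s := Metric.ball z₀ r)
    (Metric.ball_mem_nhds z₀ hr0)
    (Filter.Eventually.of_forall fun z => hg.aestronglyMeasurable.mul
      (measurable_bergmanKernel.of_uncurry_left).aestronglyMeasurable)
    (integrable_mul_bergmanKernel hα hg hz₀) hF'm ?_ (hg.norm.mul_const _) ?_
  · exact key.differentiableAt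
  · filter_upwards [ae_mem_unitBall] with w hw z hz
    have hzn := hball z hz
    have hzB : z ∈ unitBall n := mem_unitBall.2 (by linarith)
    have hlow := one_sub_norm_le_norm_one_sub_inner (z := z) hw
    simp only [F']
    rw [norm_smul, innerSL_apply_norm, norm_mul, norm_mul, mul_assoc]
    refine mul_le_mul_of_nonneg_left ?_ (norm_nonneg _)
    rw [show (-(c : ℂ) - 1) = ((-c - 1 : ℝ) : ℂ) by push_cast; ring, Complex.norm_cpow_real,
      Complex.norm_real, Real.norm_of_nonneg hc.le]
    have h3 : ‖1 - inner ℂ w z‖ ^ (-c - 1) ≤ r ^ (-c - 1) :=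
      Real.rpow_le_rpow_of_nonpos hr0 (by linarith) (by linarith)
    have h4 := (mem_unitBall.1 hw).le
    have h5 : 0 ≤ r ^ (-c - 1) := by positivity
    calc c * ‖1 - inner ℂ w z‖ ^ (-c - 1) * ‖w‖ ≤ c * r ^ (-c - 1) * 1 := by gcongr
      _ = _ := mul_one _
  · filter_upwards [ae_mem_unitBall] with w hw z hz
    have hzn := hball z hz
    have hzB : z ∈ unitBall n := mem_unitBall.2 (by linarith)
    have hi : HasFDerivAt (fun x : Cn n => (1 - inner ℂ w x : ℂ)) (-innerSL ℂ w) z :=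
      (innerSL ℂ w).hasFDerivAt.const_sub 1
    have hp : HasDerivAt (fun y : ℂ => y ^ (-(c : ℂ)))
        (-(c : ℂ) * (1 - inner ℂ w z) ^ (-(c : ℂ) - 1) * 1) (1 - inner ℂ w z) :=
      (hasDerivAt_id _).cpow_const (one_sub_inner_mem_slitPlane hw hzB)
    have h1 : HasFDerivAt (fun x : Cn n => (1 - inner ℂ w x : ℂ) ^ (-(c : ℂ)))
        ((-(c : ℂ) * (1 - inner ℂ w z) ^ (-(c : ℂ) - 1) * 1) • (-innerSL ℂ w)) z :=
      HasDerivAt.comp_hasFDerivAt (h₂ := fun y : ℂ => y ^ (-(c : ℂ))) z hp hi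
    have h2 : (fun x : Cn n => g w * bergmanKernel n α x w) =
        fun x => g w * (1 - inner ℂ w x : ℂ) ^ (-(c : ℂ)) := by
      ext x
      rw [bergmanKernel, exponent_eq, Complex.cpow_neg]
    rw [h2]
    refine (h1.const_mul (g w)).congr_fderiv ?_
    ext v
    simp [F']
    ring

end Kernel

/-! ### The mean value property at the origin -/

section MeanValue

variable {n : ℕ} {α : ℝ}

lemma measurePreserving_smul_volume {u : ℂ} (hu : ‖u‖ = 1) :
    MeasurePreserving (fun w : Cn n => u • w) volume volume := by
  have hu0 : u ≠ 0 := by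
    rintro rfl
    simp at hu
  let e : Cn n ≃ₗᵢ[ℝ] Cn n :=
    ⟨(LinearEquiv.smulOfNeZero ℂ (Cn n) u hu0).restrictScalars ℝ, fun w => by
      simp [norm_smul, hu]⟩
  exact e.measurePreserving

lemma measurePreserving_smul_weightedVolume (hα : -1 < α) {u : ℂ} (hu : ‖u‖ = 1) :
    MeasurePreserving (fun w : Cn n => u • w) (weightedVolume n α) (weightedVolume n α) := by
  have hm : Measurable fun w : Cn n => u • w := measurable_const_smul u
  refine ⟨hm, ?_⟩
  ext s hs
  have hms : Measurable (s.indicator (1 : Cn n → ℝ≥0∞)) := measurable_one.indicator hs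
  rw [Measure.map_apply hm hs, ← lintegral_indicator_one hs, ← lintegral_indicator_one (hm hs),
    lintegral_weightedVolume hα hms,
    lintegral_weightedVolume hα (measurable_one.indicator (hm hs))]
  congr 1
  have hpre : (fun w : Cn n => u • w) ⁻¹' unitBall n = unitBall n := by
    ext w
    simp [mem_unitBall, norm_smul, hu]
  have hmw : Measurable fun w : Cn n =>
      ENNReal.ofReal ((1 - ‖w‖ ^ 2) ^ α) * s.indicator (1 : Cn n → ℝ≥0∞) w :=
    (measurable_weight α).mul hms
  rw [← (measurePreserving_smul_volume hu).setLIntegral_comp_preimage measurableSet_unitBall hmw,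
    hpre]
  refine lintegral_congr fun w => ?_
  rw [norm_smul, hu, one_mul]
  rfl

/-- Since |w| < 1, the slice ζ ↦ f(ζw) is holomorphic up to the closed disc, and the mean value
property in one variable applies. -/
lemma circleAverage_slice {f : Cn n → ℂ} (hf : DifferentiableOn ℂ f (unitBall n)) {w : Cn n}
    (hw : w ∈ unitBall n) :
    Real.circleAverage (fun ζ : ℂ => f (ζ • w)) 0 1 = f 0 := by
  have h : DiffContOnCl ℂ (fun ζ : ℂ => f (ζ • w)) (Metric.ball 0 |1|) := by
    refine DifferentiableOn.diffContOnCl ?_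
    rw [abs_one, closure_ball _ one_ne_zero]
    refine hf.comp (differentiable_id.smul_const w).differentiableOn ?_
    intro ζ hζ
    rw [mem_closedBall_zero_iff] at hζ
    rw [mem_unitBall] at hw ⊢
    change ‖ζ • w‖ < 1
    rw [norm_smul]
    nlinarith [norm_nonneg w]
  rw [h.circleAverage]
  simp

/-- The measure v_α is invariant under w ↦ e^{iθ}w. Averaging the integral over θ and exchanging the
integrals replaces f(w) by its circle average, which is f(0). -/
theorem integral_eq_of_differentiableOn (hα : -1 < α) {f : Cn n → ℂ} (hfm : Measurable f)
    (hf : DifferentiableOn ℂ f (unitBall n)) (hi : Integrable f (weightedVolume n α)) :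
    ∫ w, f w ∂(weightedVolume n α) = (weightedVolume n α).real univ * f 0 := by
  have := isFiniteMeasure_weightedVolume (n := n) hα
  have hpi := Real.two_pi_pos
  have hcm : ∀ θ : ℝ, ‖circleMap 0 1 θ‖ = 1 := fun θ => by simp
  have hrot : ∀ θ : ℝ, MeasurePreserving (fun w : Cn n => circleMap 0 1 θ • w)
      (weightedVolume n α) (weightedVolume n α) := fun θ =>
    measurePreserving_smul_weightedVolume hα (hcm θ)
  have hΦm : Measurable fun q : ℝ × Cn n => f (circleMap 0 1 q.1 • q.2) :=
    hfm.comp (((continuous_circleMap 0 1).measurable.comp measurable_fst).smul measurable_snd)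
  have hΦi : Integrable (fun q : ℝ × Cn n => f (circleMap 0 1 q.1 • q.2))
      ((volume.restrict (Ioc 0 (2 * Real.pi))).prod (weightedVolume n α)) := by
    rw [integrable_prod_iff hΦm.aestronglyMeasurable]
    refine ⟨Filter.Eventually.of_forall fun θ =>
      ((hrot θ).integrable_comp hfm.aestronglyMeasurable).2 hi, ?_⟩
    have : ∀ θ : ℝ, ∫ w, ‖f (circleMap 0 1 θ • w)‖ ∂(weightedVolume n α) =
        ∫ w, ‖f w‖ ∂(weightedVolume n α) := fun θ => by
      have h := integral_map (hrot θ).measurable.aemeasurable (μ := weightedVolume n α)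
        (f := fun w => ‖f w‖) (hfm.norm.aestronglyMeasurable)
      rw [(hrot θ).map_eq] at h
      exact h.symm
    simp only [this]
    exact integrable_const _
  have hswap := integral_integral_swap (f := fun (θ : ℝ) (w : Cn n) => f (circleMap 0 1 θ • w)) hΦi
  have hl : ∀ θ : ℝ, ∫ w, f (circleMap 0 1 θ • w) ∂(weightedVolume n α) =
      ∫ w, f w ∂(weightedVolume n α) := fun θ => by
    have h := integral_map (hrot θ).measurable.aemeasurable (μ := weightedVolume n α)
      (f := f) hfm.aestronglyMeasurable
    rw [(hrot θ).map_eq] at h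
    exact h.symm
  have hr : ∀ᵐ w ∂(weightedVolume n α),
      ∫ θ in Ioc 0 (2 * Real.pi), f (circleMap 0 1 θ • w) = 2 * Real.pi * f 0 := by
    filter_upwards [ae_mem_unitBall] with w hw
    have h := circleAverage_slice hf hw
    rw [Real.circleAverage, intervalIntegral.integral_of_le hpi.le] at h
    rw [← h, Complex.real_smul, ← mul_assoc]
    push_cast
    rw [mul_inv_cancel₀ (by exact_mod_cast hpi.ne'), one_mul]
  simp only [hl] at hswap
  rw [integral_congr_ae hr, integral_const, integral_const] at hswap
  simp only [Complex.real_smul, measureReal_restrict_apply_univ, Real.volume_real_Ioc, sub_zero,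
    max_eq_left hpi.le] at hswap
  have h2 : ((2 * Real.pi : ℝ) : ℂ) ≠ 0 := by exact_mod_cast hpi.ne'
  apply mul_left_cancel₀ h2
  rw [hswap]
  push_cast
  ring

end MeanValue

/-! ### The reproducing formula -/

section Reproducing

variable {n : ℕ} {α : ℝ}

/-- The density `(1 - |w|²)^(n+1+α)` of `v_α` with respect to the invariant measure. -/
def invDensity (n : ℕ) (α : ℝ) (w : Cn n) : ℝ := (1 - ‖w‖ ^ 2) ^ ((n : ℝ) + 1 + α)

lemma measurable_invDensity : Measurable (invDensity n α) := by
  unfold invDensity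
  fun_prop

lemma invDensity_pos {w : Cn n} (hw : w ∈ unitBall n) : 0 < invDensity n α w := by
  have := one_sub_norm_sq_pos hw
  unfold invDensity
  positivity

lemma integrable_weightedVolume_iff (hα : -1 < α) {g : Cn n → ℂ} :
    Integrable g (weightedVolume n α) ↔
      Integrable (fun w => (invDensity n α w : ℂ) * g w) (invariantMeasure n α) := by
  rw [weightedVolume_eq_withDensity hα, integrable_withDensity_iff_integrable_smul'
    (measurable_weight _) (Filter.Eventually.of_forall fun _ => ENNReal.ofReal_lt_top)]
  refine integrable_congr ?_
  filter_upwards [ae_mem_unitBall_invariantMeasure] with w hw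
  have h : (ENNReal.ofReal ((1 - ‖w‖ ^ 2) ^ ((n : ℝ) + 1 + α))).toReal = invDensity n α w :=
    ENNReal.toReal_ofReal (invDensity_pos hw).le
  rw [h, Complex.real_smul]

lemma integral_weightedVolume (hα : -1 < α) (g : Cn n → ℂ) :
    ∫ w, g w ∂(weightedVolume n α) =
      ∫ w, (invDensity n α w : ℂ) * g w ∂(invariantMeasure n α) := by
  rw [weightedVolume_eq_withDensity hα, integral_withDensity_eq_integral_toReal_smul
    (measurable_weight _) (Filter.Eventually.of_forall fun _ => ENNReal.ofReal_lt_top)]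
  refine integral_congr_ae ?_
  filter_upwards [ae_mem_unitBall_invariantMeasure] with w hw
  have h : (ENNReal.ofReal ((1 - ‖w‖ ^ 2) ^ ((n : ℝ) + 1 + α))).toReal = invDensity n α w :=
    ENNReal.toReal_ofReal (invDensity_pos hw).le
  rw [h, Complex.real_smul]

lemma lintegral_weightedVolume_eq_invariantMeasure (hα : -1 < α) {g : Cn n → ℝ≥0∞}
    (hg : Measurable g) :
    ∫⁻ w, g w ∂(weightedVolume n α) =
      ∫⁻ w, ENNReal.ofReal (invDensity n α w) * g w ∂(invariantMeasure n α) := by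
  rw [weightedVolume_eq_withDensity hα,
    lintegral_withDensity_eq_lintegral_mul _ (measurable_weight _) hg]
  rfl

lemma ofReal_cpow_exponent {x : ℝ} (hx : 0 ≤ x) :
    (x : ℂ) ^ ((n : ℂ) + 1 + (α : ℂ)) = ((x ^ ((n : ℝ) + 1 + α) : ℝ) : ℂ) := by
  rw [exponent_eq, Complex.ofReal_cpow hx]

lemma bergmanKernel_conj {z w : Cn n} (hz : z ∈ unitBall n) (hw : w ∈ unitBall n) :
    bergmanKernel n α z w = starRingEnd ℂ (bergmanKernel n α w z) := by
  have h1 : (1 - inner ℂ z w).arg ≠ Real.pi :=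
    Complex.slitPlane_arg_ne_pi (one_sub_inner_mem_slitPlane hz hw)
  have h : 1 - inner ℂ w z = starRingEnd ℂ (1 - inner ℂ z w) := by simp
  rw [bergmanKernel, bergmanKernel, map_inv₀, h, Complex.conj_cpow _ _ h1, exponent_eq,
    Complex.conj_ofReal]

/-- The reproducing formula for the Bergman kernel. -/
theorem reproducing_formula (hα : -1 < α) {f : Cn n → ℂ} (hfm : Measurable f)
    (hf : DifferentiableOn ℂ f (unitBall n)) (hi : Integrable f (weightedVolume n α))
    {z : Cn n} (hz : z ∈ unitBall n) :
    (weightedVolume n α).real univ * f z = bergmanProjection n α f z := by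
  set e : ℂ := (n : ℂ) + 1 + (α : ℂ) with he
  have hc := exponent_pos (n := n) hα
  -- The mean value property is applied to G = (fJ) ∘ φ_z, with G(0) = f(z) D(z). Substituting φ_z
  -- in ∫ G dv_α turns D into D(φ_z u) = D(z) D(u) / |J(u)|²; one factor J cancels, and 1 / conj
  -- J(u) is the Bergman kernel.
  let J : Cn n → ℂ := fun u => (1 - inner ℂ z u) ^ e
  have hJm : Measurable J := by
    have : Measurable fun u : Cn n => (1 - inner ℂ z u : ℂ) :=
      (continuous_const.sub (continuous_const.inner continuous_id)).measurable
    exact this.pow_const _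
  let G : Cn n → ℂ := fun ξ => f (ballAut z ξ) * J (ballAut z ξ)
  let H : Cn n → ℂ := fun u => (invDensity n α (ballAut z u) : ℂ) * (f u * J u)
  have hGm : Measurable G := (hfm.mul hJm).comp (measurable_ballAut_right z)
  have hHm : Measurable H :=
    (Complex.measurable_ofReal.comp (measurable_invDensity.comp (measurable_ballAut_right z))).mul
      (hfm.mul hJm)
  have hmp := measurePreserving_ballAut_invariantMeasure (α := α) hz
  have hHG : ∀ᵐ ξ ∂(invariantMeasure n α), H (ballAut z ξ) = (invDensity n α ξ : ℂ) * G ξ := by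
    filter_upwards [ae_mem_unitBall_invariantMeasure] with ξ hξ
    simp only [H, G]
    rw [ballAut_ballAut hz hξ]
  have hHf : ∀ᵐ u ∂(invariantMeasure n α), H u = (invDensity n α u : ℂ) *
      ((invDensity n α z : ℂ) * (f u * bergmanKernel n α z u)) := by
    filter_upwards [ae_mem_unitBall_invariantMeasure] with u hu
    have hd0 := one_sub_inner_ne_zero hz hu
    have hd := norm_pos_iff.2 hd0
    have h1 := one_sub_norm_sq_pos hz
    have h2 := one_sub_norm_sq_pos hu
    have hJ0 : J u ≠ 0 := by
      simp only [J]
      rw [Ne, Complex.cpow_eq_zero_iff]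
      exact fun h => hd0 h.1
    have hnJ : ‖J u‖ = ‖1 - inner ℂ z u‖ ^ ((n : ℝ) + 1 + α) := by
      simp only [J, he]
      rw [exponent_eq, Complex.norm_cpow_real]
    have hK : bergmanKernel n α z u = (starRingEnd ℂ (J u))⁻¹ := by
      rw [bergmanKernel_conj hz hu, bergmanKernel, map_inv₀]
    have hden : invDensity n α (ballAut z u) =
        invDensity n α z * invDensity n α u / ‖J u‖ ^ 2 := by
      rw [invDensity, one_sub_norm_sq_ballAut hz hu, Real.div_rpow (by positivity) (by positivity),
        Real.mul_rpow h1.le h2.le, hnJ, Real.rpow_pow_comm hd.le]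
      rfl
    have hJJ : ((‖J u‖ ^ 2 : ℝ) : ℂ) = J u * starRingEnd ℂ (J u) := by
      rw [Complex.mul_conj']
      push_cast
      rfl
    have hJc : starRingEnd ℂ (J u) ≠ 0 := (map_ne_zero _).2 hJ0
    simp only [H]
    rw [hden, hK, Complex.ofReal_div, hJJ]
    push_cast
    field_simp
  have hGd : DifferentiableOn ℂ G (unitBall n) := by
    have hφ : DifferentiableOn ℂ (ballAut z) (unitBall n) := fun w hw =>
      (hasFDerivAt_ballAut hz hw).differentiableAt.differentiableWithinAt
    have hJd : DifferentiableOn ℂ J (unitBall n) := by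
      refine DifferentiableOn.cpow_const ?_ fun u hu => one_sub_inner_mem_slitPlane hz hu
      exact ((innerSL ℂ z).differentiable.const_sub 1).differentiableOn
    exact (hf.mul hJd).comp hφ fun w hw => ballAut_mem hz hw
  have hKi := integrable_mul_bergmanKernel hα hi hz
  have hHi : Integrable H (invariantMeasure n α) :=
    (integrable_congr hHf).2 ((integrable_weightedVolume_iff hα).1 (hKi.const_mul _))
  -- Integrability of G is transported back through φ_z from that of f times the kernel, which is
  -- bounded in w for fixed z.
  have hGi : Integrable G (weightedVolume n α) := by
    rw [integrable_weightedVolume_iff hα, ← integrable_congr hHG]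
    exact (hmp.integrable_comp hHm.aestronglyMeasurable).2 hHi
  have hmean := integral_eq_of_differentiableOn hα hGm hGd hGi
  have hswap : ∫ w, G w ∂(weightedVolume n α) =
      (invDensity n α z : ℂ) * bergmanProjection n α f z := by
    have h := integral_map hmp.measurable.aemeasurable (μ := invariantMeasure n α)
      (f := H) hHm.aestronglyMeasurable
    rw [hmp.map_eq] at h
    rw [integral_weightedVolume hα, ← integral_congr_ae hHG, ← h, integral_congr_ae hHf,
      ← integral_weightedVolume hα, integral_const_mul, bergmanProjection_eq]
  have hG0 : G 0 = f z * (invDensity n α z : ℂ) := by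
    simp only [G, J]
    rw [ballAut_zero, inner_self_eq_ofReal, he, invDensity,
      ← ofReal_cpow_exponent (one_sub_norm_sq_pos hz).le]
    push_cast
    rfl
  rw [hswap, hG0] at hmean
  have h0 : (invDensity n α z : ℂ) ≠ 0 := by exact_mod_cast (invDensity_pos hz).ne'
  apply mul_left_cancel₀ h0
  rw [hmean]
  ring

end Reproducing

/-! ### Slow variation of kernel and density in the pseudohyperbolic metric -/

section Variation

variable {n : ℕ} {α : ℝ}

lemma pseudohyp_nonneg (w u : Cn n) : 0 ≤ pseudohyp w u := norm_nonneg _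

/-- With ξ = φ_w(u) and ζ = φ_w(x) the quotient equals (1 - ⟨ξ, ζ⟩) / (1 - ⟨ξ, w⟩). Here |ξ| = ρ(w,
u) ≤ t while |ζ| and |w| are below 1, so the bound is uniform in x. -/
lemma norm_one_sub_inner_div_sub_one_le {w u x : Cn n} (hw : w ∈ unitBall n)
    (hu : u ∈ unitBall n) (hx : x ∈ unitBall n) {t : ℝ} (ht : pseudohyp w u ≤ t) (ht1 : t < 1) :
    ‖(1 - inner ℂ u x) / (1 - inner ℂ w x) - 1‖ ≤ 2 * t / (1 - t) := by
  have hξ := ballAut_mem hw hu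
  have hζ := ballAut_mem hw hx
  have h1 := one_sub_inner_ballAut hw hξ hζ
  have h2 := inner_ballAut_right hw hζ
  rw [ballAut_ballAut hw hu, ballAut_ballAut hw hx] at h1
  rw [ballAut_ballAut hw hx] at h2
  set ξ := ballAut w u with hξdef
  set ζ := ballAut w x
  have hs0 : (defect w : ℂ) ≠ 0 := by exact_mod_cast (defect_pos hw).ne'
  have e1 := one_sub_inner_ne_zero hξ hw
  have e2 := one_sub_inner_ne_zero hw hζ
  have e3 : (1 - inner ℂ u x) / (1 - inner ℂ w x) - 1 =
      (inner ℂ ξ w - inner ℂ ξ ζ) / (1 - inner ℂ ξ w) := by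
    rw [h1, h2]
    field_simp
    ring
  have ht0 : ‖ξ‖ ≤ t := ht
  have hw1 := (mem_unitBall.1 hw).le
  have hζ1 := (mem_unitBall.1 hζ).le
  have n1 : ‖inner ℂ ξ w‖ ≤ t :=
    (norm_inner_le_norm ξ w).trans (by nlinarith [norm_nonneg ξ, norm_nonneg w])
  have n2 : ‖inner ℂ ξ ζ‖ ≤ t :=
    (norm_inner_le_norm ξ ζ).trans (by nlinarith [norm_nonneg ξ, norm_nonneg ζ])
  have n3 : 1 - t ≤ ‖1 - inner ℂ ξ w‖ := by
    have := norm_sub_norm_le (1 : ℂ) (inner ℂ ξ w)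
    rw [norm_one] at this
    linarith
  rw [e3, norm_div]
  have h4 : ‖inner ℂ ξ w - inner ℂ ξ ζ‖ ≤ 2 * t := (norm_sub_le _ _).trans (by linarith)
  have : 0 ≤ t := (norm_nonneg _).trans ht0
  have : 0 < 1 - t := by linarith
  gcongr

lemma exists_norm_one_sub_inner_div_sub_one_lt (n : ℕ) {ε : ℝ} (hε : 0 < ε) :
    ∃ δ > 0, ∀ w ∈ unitBall n, ∀ u ∈ unitBall n, ∀ x ∈ unitBall n, pseudohyp w u < δ →
      ‖(1 - inner ℂ u x) / (1 - inner ℂ w x) - 1‖ < ε := by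
  -- For t ≤ 1/2 the bound 2t / (1 - t) is at most 4t.
  refine ⟨min (1 / 2) (ε / 8), by positivity, fun w hw u hu x hx h => ?_⟩
  have h1 := h.le.trans (min_le_left _ _)
  have h2 := h.trans_le (min_le_right _ _)
  refine (norm_one_sub_inner_div_sub_one_le hw hu hx le_rfl (by linarith)).trans_lt ?_
  rw [div_lt_iff₀ (by linarith)]
  nlinarith [pseudohyp_nonneg w u]

/-- Expresses the ratio of the weights through ρ and the quotient of the previous lemmas at x = w,
so that its closeness to 1 follows by continuity. -/
lemma one_sub_norm_sq_div_eq {w u : Cn n} (hw : w ∈ unitBall n) (hu : u ∈ unitBall n) :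
    (1 - ‖u‖ ^ 2) / (1 - ‖w‖ ^ 2) = (1 - pseudohyp w u ^ 2) *
      ‖(1 - inner ℂ u w) / (1 - inner ℂ w w)‖ ^ 2 := by
  have h1 := one_sub_norm_sq_pos hw
  have h3 := norm_pos_iff.2 (one_sub_inner_ne_zero hw hu)
  have h : 1 - inner ℂ u w = starRingEnd ℂ (1 - inner ℂ w u) := by simp
  have e : ‖1 - inner ℂ w w‖ = 1 - ‖w‖ ^ 2 := by
    rw [inner_self_eq_ofReal, ← Complex.ofReal_one, ← Complex.ofReal_sub, Complex.norm_real,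
      Real.norm_of_nonneg h1.le]
  rw [pseudohyp, one_sub_norm_sq_ballAut hw hu, norm_div, h, Complex.norm_conj, e]
  field_simp

lemma exists_abs_one_sub_norm_sq_div_sub_one_lt (n : ℕ) {ε : ℝ} (hε : 0 < ε) :
    ∃ δ > 0, ∀ w ∈ unitBall n, ∀ u ∈ unitBall n, pseudohyp w u < δ →
      |(1 - ‖u‖ ^ 2) / (1 - ‖w‖ ^ 2) - 1| < ε := by
  have hcont : ContinuousAt (fun q : ℝ × ℂ => (1 - q.1 ^ 2) * ‖q.2‖ ^ 2) (0, 1) := by fun_prop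
  obtain ⟨η, hη, hη'⟩ := Metric.continuousAt_iff.1 hcont ε hε
  obtain ⟨δ, hδ, hδ'⟩ := exists_norm_one_sub_inner_div_sub_one_lt n hη
  refine ⟨min δ η, lt_min hδ hη, fun w hw u hu h => ?_⟩
  have h1 := hδ' w hw u hu w hw (h.trans_le (min_le_left _ _))
  have h2 := h.trans_le (min_le_right _ _)
  have h3 := hη' (x := (pseudohyp w u, (1 - inner ℂ u w) / (1 - inner ℂ w w))) (by
    rw [Prod.dist_eq]
    refine max_lt ?_ ?_
    · simpa [abs_of_nonneg (pseudohyp_nonneg w u)] using h2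
    · simpa [dist_eq_norm] using h1)
  rw [one_sub_norm_sq_div_eq hw hu]
  simpa [Real.dist_eq] using h3

/-- Both numbers have positive real part, so their arguments differ by less than π and the principal
logarithms subtract. -/
lemma bergmanKernel_div {w u x : Cn n} (hw : w ∈ unitBall n) (hu : u ∈ unitBall n)
    (hx : x ∈ unitBall n) : bergmanKernel n α x u / bergmanKernel n α x w =
      ((1 - inner ℂ u x) / (1 - inner ℂ w x)) ^ (-((n : ℂ) + 1 + (α : ℂ))) := by
  have a1 := Complex.abs_arg_lt_pi_div_two_iff.2 (Or.inl (re_one_sub_inner_pos hu hx))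
  have a2 := Complex.abs_arg_lt_pi_div_two_iff.2 (Or.inl (re_one_sub_inner_pos hw hx))
  have h1 := one_sub_inner_ne_zero hu hx
  have h2 := one_sub_inner_ne_zero hw hx
  have e : Complex.log ((1 - inner ℂ u x) / (1 - inner ℂ w x)) =
      Complex.log (1 - inner ℂ u x) - Complex.log (1 - inner ℂ w x) := by
    have a3 : (1 - inner ℂ w x).arg ≠ Real.pi :=
      Complex.slitPlane_arg_ne_pi (one_sub_inner_mem_slitPlane hw hx)
    rw [div_eq_mul_inv, (Complex.log_mul_eq_add_log_iff h1 (inv_ne_zero h2)).2, Complex.log_inv _ a3]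
    · ring
    rw [Complex.arg_inv, if_neg a3]
    rw [abs_lt] at a1 a2
    constructor <;> linarith
  rw [bergmanKernel, bergmanKernel, ← Complex.cpow_neg, ← Complex.cpow_neg,
    Complex.cpow_def_of_ne_zero h1, Complex.cpow_def_of_ne_zero h2,
    Complex.cpow_def_of_ne_zero (div_ne_zero h1 h2), e, ← Complex.exp_sub]
  congr 1
  ring

/-- The Bergman kernel varies slowly in the pseudohyperbolic metric. -/
theorem exists_norm_bergmanKernel_sub_le (n : ℕ) (α : ℝ) {ε : ℝ} (hε : 0 < ε) :
    ∃ δ > 0, ∀ w ∈ unitBall n, ∀ u ∈ unitBall n, ∀ x ∈ unitBall n, pseudohyp w u < δ →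
      ‖bergmanKernel n α x u - bergmanKernel n α x w‖ ≤ ε * ‖bergmanKernel n α x w‖ := by
  have hcont : ContinuousAt (fun y : ℂ => y ^ (-((n : ℂ) + 1 + (α : ℂ)))) 1 :=
    continuousAt_cpow_const (Or.inl (by simp))
  obtain ⟨η, hη, hη'⟩ := Metric.continuousAt_iff.1 hcont ε hε
  obtain ⟨δ, hδ, hδ'⟩ := exists_norm_one_sub_inner_div_sub_one_lt n hη
  refine ⟨δ, hδ, fun w hw u hu x hx h => ?_⟩
  have h1 := hη' (x := (1 - inner ℂ u x) / (1 - inner ℂ w x))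
    (by rw [dist_eq_norm]; exact hδ' w hw u hu x hx h)
  rw [← bergmanKernel_div hw hu hx, Complex.one_cpow, dist_eq_norm] at h1
  have hK : bergmanKernel n α x w ≠ 0 := by
    rw [bergmanKernel, Ne, inv_eq_zero, Complex.cpow_eq_zero_iff]
    exact fun h => one_sub_inner_ne_zero hw hx h.1
  have e : bergmanKernel n α x u - bergmanKernel n α x w =
      (bergmanKernel n α x u / bergmanKernel n α x w - 1) * bergmanKernel n α x w := by
    field_simp
  rw [e, norm_mul]
  gcongr

/-- The density of `v_α` varies slowly in the pseudohyperbolic metric. -/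
theorem exists_abs_invDensity_sub_le (n : ℕ) (α : ℝ) {ε : ℝ} (hε : 0 < ε) :
    ∃ δ > 0, ∀ w ∈ unitBall n, ∀ u ∈ unitBall n, pseudohyp w u < δ →
      |invDensity n α u - invDensity n α w| ≤ ε * invDensity n α w := by
  have hcont : ContinuousAt (fun y : ℝ => y ^ ((n : ℝ) + 1 + α)) 1 :=
    Real.continuousAt_rpow_const _ _ (Or.inl one_ne_zero)
  obtain ⟨η, hη, hη'⟩ := Metric.continuousAt_iff.1 hcont ε hε
  obtain ⟨δ, hδ, hδ'⟩ := exists_abs_one_sub_norm_sq_div_sub_one_lt n hη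
  refine ⟨δ, hδ, fun w hw u hu h => ?_⟩
  have h1 := hη' (x := (1 - ‖u‖ ^ 2) / (1 - ‖w‖ ^ 2))
    (by rw [Real.dist_eq]; exact hδ' w hw u hu h)
  have p1 := one_sub_norm_sq_pos hw
  have p2 := one_sub_norm_sq_pos hu
  have p3 := invDensity_pos (α := α) hw
  rw [Real.one_rpow, Real.dist_eq, Real.div_rpow p2.le p1.le] at h1
  change |invDensity n α u / invDensity n α w - 1| < ε at h1
  have e : invDensity n α u - invDensity n α w =
      (invDensity n α u / invDensity n α w - 1) * invDensity n α w := by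
    field_simp
  rw [e, abs_mul, abs_of_pos p3]
  gcongr

end Variation

/-! ### Oscillation of the Toeplitz integrand -/

section Oscillation

variable {n : ℕ} {α : ℝ}

lemma weightedVolume_real_univ_pos (hα : -1 < α) : 0 < (weightedVolume n α).real univ := by
  have := isFiniteMeasure_weightedVolume (n := n) hα
  exact ENNReal.toReal_pos (weightedVolume_univ_ne_zero hα) (measure_ne_top _ _)

/-- A holomorphic integrable function times the kernel and the density varies slowly. -/
theorem exists_norm_density_mul_kernel_sub_le (n : ℕ) {α : ℝ} (hα : -1 < α) {ε : ℝ}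
    (hε : 0 < ε) : ∃ δ > 0, ∀ f : Cn n → ℂ, Measurable f → DifferentiableOn ℂ f (unitBall n) →
      Integrable f (weightedVolume n α) → ∀ w ∈ unitBall n, ∀ u ∈ unitBall n, ∀ x ∈ unitBall n,
      pseudohyp w u < δ →
      ‖(invDensity n α w : ℂ) * (f w * bergmanKernel n α x w) -
        (invDensity n α u : ℂ) * (f u * bergmanKernel n α x u)‖ ≤
      ε * (invDensity n α w * ‖bergmanKernel n α x w‖ *
        ∫ y, ‖f y * bergmanKernel n α w y‖ ∂(weightedVolume n α)) := by
  set m := (weightedVolume n α).real univ with hm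
  have hm0 : 0 < m := weightedVolume_real_univ_pos hα
  -- The 7 is 2·3 + 1: below, m|f(u)| ≤ 2Q multiplies a relative change 3η of the density times the
  -- kernel, and f itself contributes η. The bound η ≤ 1 absorbs η².
  set η := min 1 (ε * m / 7) with hη
  have hη0 : 0 < η := by positivity
  have hη1 : η ≤ 1 := min_le_left _ _
  have hη2 : 7 * η ≤ ε * m := by
    have := min_le_right 1 (ε * m / 7)
    linarith
  obtain ⟨δ₁, hδ₁, h₁⟩ := exists_norm_bergmanKernel_sub_le n α hη0
  obtain ⟨δ₂, hδ₂, h₂⟩ := exists_abs_invDensity_sub_le n α hη0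
  refine ⟨min δ₁ δ₂, lt_min hδ₁ hδ₂, fun f hfm hf hi w hw u hu x hx h => ?_⟩
  have hK := h₁ w hw u hu x hx (h.trans_le (min_le_left _ _))
  have hD := h₂ w hw u hu (h.trans_le (min_le_right _ _))
  have hD0 := invDensity_pos (α := α) hw
  set Q := ∫ y, ‖f y * bergmanKernel n α w y‖ ∂(weightedVolume n α) with hQ
  have hQ0 : 0 ≤ Q := integral_nonneg fun _ => norm_nonneg _
  have hiw := integrable_mul_bergmanKernel hα hi hw
  have hiu := integrable_mul_bergmanKernel hα hi hu
  have hfw : m * ‖f w‖ ≤ Q := by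
    have h := reproducing_formula hα hfm hf hi hw
    calc m * ‖f w‖ = ‖(m : ℂ) * f w‖ := by rw [norm_mul, Complex.norm_real, Real.norm_of_nonneg hm0.le]
      _ ≤ Q := by
        rw [h, bergmanProjection_eq]
        exact norm_integral_le_integral_norm _
  -- By the reproducing formula the left side is an integral of f against K(u, ·) - K(w, ·).
  -- Conjugate symmetry moves u and w to the second slot, where the slow variation of the kernel is
  -- stated.
  have hfu : m * ‖f u - f w‖ ≤ η * Q := by
    have h1 := reproducing_formula hα hfm hf hi hw
    have h2 := reproducing_formula hα hfm hf hi hu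
    calc m * ‖f u - f w‖ = ‖(m : ℂ) * f u - m * f w‖ := by
          rw [← mul_sub, norm_mul, Complex.norm_real, Real.norm_of_nonneg hm0.le]
      _ ≤ η * Q := by
        rw [h1, h2, bergmanProjection_eq, bergmanProjection_eq, ← integral_sub hiu hiw, hQ,
          ← integral_const_mul]
        refine norm_integral_le_of_norm_le (hiw.norm.const_mul _) ?_
        filter_upwards [ae_mem_unitBall] with y hy
        rw [← mul_sub, norm_mul, norm_mul, mul_left_comm]
        refine mul_le_mul_of_nonneg_left ?_ (norm_nonneg _)
        rw [bergmanKernel_conj hu hy, bergmanKernel_conj hw hy, ← map_sub, Complex.norm_conj,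
          Complex.norm_conj]
        exact h₁ w hw u hu y hy (h.trans_le (min_le_left _ _))
  set D := invDensity n α w
  set D' := invDensity n α u
  set K := bergmanKernel n α x w
  set K' := bergmanKernel n α x u
  have hK' : ‖K'‖ ≤ (1 + η) * ‖K‖ := by
    have := norm_le_norm_add_norm_sub' K' K
    linarith
  have hDK : ‖(D' : ℂ) * K' - D * K‖ ≤ 3 * η * (D * ‖K‖) := by
    have e : (D' : ℂ) * K' - D * K = ((D' - D : ℝ) : ℂ) * K' + D * (K' - K) := by
      push_cast
      ring
    rw [e]
    refine (norm_add_le _ _).trans ?_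
    rw [norm_mul, norm_mul, Complex.norm_real, Complex.norm_real, Real.norm_eq_abs,
      Real.norm_of_nonneg hD0.le]
    have a1 : |D' - D| * ‖K'‖ ≤ η * D * ((1 + η) * ‖K‖) := by gcongr
    have a2 : D * ‖K' - K‖ ≤ D * (η * ‖K‖) := by gcongr
    have a3 : 0 ≤ η * (D * ‖K‖) * (1 - η) :=
      mul_nonneg (by positivity) (by linarith)
    nlinarith
  have hfu' : m * ‖f u‖ ≤ 2 * Q := by
    have := norm_le_norm_add_norm_sub' (f u) (f w)
    nlinarith
  have e : (D : ℂ) * (f w * K) - D' * (f u * K') =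
      -(f u * ((D' : ℂ) * K' - D * K) + (f u - f w) * (D * K)) := by ring
  have hDKn : ‖(D : ℂ) * K‖ = D * ‖K‖ := by
    rw [norm_mul, Complex.norm_real, Real.norm_of_nonneg hD0.le]
  have hfin : m * ‖(D : ℂ) * (f w * K) - D' * (f u * K')‖ ≤ 7 * η * (D * ‖K‖ * Q) := by
    rw [e, norm_neg]
    have b0 : 0 ≤ D * ‖K‖ := by positivity
    calc m * ‖f u * ((D' : ℂ) * K' - D * K) + (f u - f w) * (D * K)‖
        ≤ m * (‖f u‖ * ‖(D' : ℂ) * K' - D * K‖ + ‖f u - f w‖ * ‖(D : ℂ) * K‖) := by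
          gcongr
          refine (norm_add_le _ _).trans (le_of_eq ?_)
          rw [norm_mul, norm_mul]
      _ = (m * ‖f u‖) * ‖(D' : ℂ) * K' - D * K‖ + (m * ‖f u - f w‖) * (D * ‖K‖) := by
          rw [hDKn]; ring
      _ ≤ (2 * Q) * (3 * η * (D * ‖K‖)) + (η * Q) * (D * ‖K‖) := by gcongr
      _ = _ := by ring
  have hb : 0 ≤ D * ‖K‖ * Q := by positivity
  refine le_of_mul_le_mul_left (hfin.trans ?_) hm0
  calc 7 * η * (D * ‖K‖ * Q) ≤ ε * m * (D * ‖K‖ * Q) := by gcongr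
    _ = _ := by ring

end Oscillation

/-! ### Averaging symbols over pseudohyperbolic balls -/

section Bump

variable {n : ℕ} {α : ℝ}

lemma measurable_pseudohyp : Measurable fun q : Cn n × Cn n => pseudohyp q.1 q.2 :=
  measurable_ballAut.norm

lemma one_sub_pseudohyp_sq {u w : Cn n} (hu : u ∈ unitBall n) (hw : w ∈ unitBall n) :
    1 - pseudohyp u w ^ 2 = (1 - ‖u‖ ^ 2) * (1 - ‖w‖ ^ 2) / ‖1 - inner ℂ u w‖ ^ 2 :=
  one_sub_norm_sq_ballAut hu hw

lemma pseudohyp_comm {u w : Cn n} (hu : u ∈ unitBall n) (hw : w ∈ unitBall n) :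
    pseudohyp u w = pseudohyp w u := by
  have h : 1 - inner ℂ w u = starRingEnd ℂ (1 - inner ℂ u w) := by simp
  have h1 : 1 - pseudohyp u w ^ 2 = 1 - pseudohyp w u ^ 2 := by
    rw [one_sub_pseudohyp_sq hu hw, one_sub_pseudohyp_sq hw hu, h, Complex.norm_conj]
    ring
  rw [← sq_eq_sq₀ (pseudohyp_nonneg _ _) (pseudohyp_nonneg _ _)]
  linarith

lemma pseudohyp_lt_one {u w : Cn n} (hu : u ∈ unitBall n) (hw : w ∈ unitBall n) :
    pseudohyp u w < 1 := mem_unitBall.1 (ballAut_mem hu hw)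

/-- A bump function supported in the pseudohyperbolic `t`-neighbourhood of the diagonal. -/
def bump (t : ℝ) (u w : Cn n) : ℝ := max 0 (t ^ 2 - pseudohyp u w ^ 2)

lemma bump_nonneg (t : ℝ) (u w : Cn n) : 0 ≤ bump t u w := le_max_left _ _

lemma bump_comm {t : ℝ} {u w : Cn n} (hu : u ∈ unitBall n) (hw : w ∈ unitBall n) :
    bump t u w = bump t w u := by rw [bump, bump, pseudohyp_comm hu hw]

lemma pseudohyp_lt_of_bump_ne_zero {t : ℝ} (ht : 0 ≤ t) {u w : Cn n} (h : bump t u w ≠ 0) :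
    pseudohyp u w < t := by
  by_contra! h1
  refine h (max_eq_left ?_)
  nlinarith

lemma measurable_bump (t : ℝ) : Measurable fun q : Cn n × Cn n => bump t q.1 q.2 :=
  measurable_const.max (measurable_const.sub (measurable_pseudohyp.pow_const 2))

lemma measurable_bump_right (t : ℝ) (u : Cn n) : Measurable (bump t u) :=
  measurable_const.max (measurable_const.sub ((measurable_ballAut_right u).norm.pow_const 2))

/-- The integral of the bump function, which does not depend on the base point. -/
def bumpMass (n : ℕ) (α t : ℝ) : ℝ≥0∞ :=
  ∫⁻ ξ, ENNReal.ofReal (max 0 (t ^ 2 - ‖ξ‖ ^ 2)) ∂(invariantMeasure n α)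

lemma lintegral_bump {t : ℝ} {u : Cn n} (hu : u ∈ unitBall n) :
    ∫⁻ w, ENNReal.ofReal (bump t u w) ∂(invariantMeasure n α) = bumpMass n α t :=
  (measurePreserving_ballAut_invariantMeasure hu).lintegral_comp
    (f := fun ξ => ENNReal.ofReal (max 0 (t ^ 2 - ‖ξ‖ ^ 2))) (by fun_prop)

lemma lintegral_bump_left {t : ℝ} {w : Cn n} (hw : w ∈ unitBall n) :
    ∫⁻ u, ENNReal.ofReal (bump t u w) ∂(invariantMeasure n α) = bumpMass n α t := by
  rw [← lintegral_bump hw]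
  refine lintegral_congr_ae ?_
  filter_upwards [ae_mem_unitBall_invariantMeasure] with u hu
  rw [bump_comm hu hw]

lemma bumpMass_eq (t : ℝ) : bumpMass n α t = volumeConst n α * ∫⁻ w in unitBall n,
    ENNReal.ofReal (((1 - ‖w‖ ^ 2) ^ (n + 1))⁻¹) *
      ENNReal.ofReal (max 0 (t ^ 2 - ‖w‖ ^ 2)) := by
  rw [bumpMass, invariantMeasure, lintegral_smul_measure, lintegral_hyperbolicVolume (by fun_prop),
    smul_eq_mul]

/-- The bump vanishes for |w| ≥ t < 1, and inside that radius the invariant density is bounded. -/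
lemma bumpMass_ne_top {t : ℝ} (ht0 : 0 ≤ t) (ht : t < 1) : bumpMass n α t ≠ ∞ := by
  have h1 : 0 < 1 - t ^ 2 := by nlinarith
  rw [bumpMass_eq]
  refine ENNReal.mul_ne_top volumeConst_ne_top (ne_of_lt ?_)
  have hle : ∀ w ∈ unitBall n, ENNReal.ofReal (((1 - ‖w‖ ^ 2) ^ (n + 1))⁻¹) *
      ENNReal.ofReal (max 0 (t ^ 2 - ‖w‖ ^ 2)) ≤ ENNReal.ofReal (((1 - t ^ 2) ^ (n + 1))⁻¹) := by
    intro w hw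
    have hw' := one_sub_norm_sq_pos hw
    rcases le_or_gt (t ^ 2) (‖w‖ ^ 2) with h | h
    · rw [max_eq_left (by linarith), ENNReal.ofReal_zero, mul_zero]
      exact zero_le
    · rw [max_eq_right (by linarith), ← ENNReal.ofReal_mul (by positivity)]
      refine ENNReal.ofReal_le_ofReal ?_
      have h2 : ((1 - ‖w‖ ^ 2) ^ (n + 1))⁻¹ ≤ ((1 - t ^ 2) ^ (n + 1))⁻¹ := by gcongr
      have h3 : t ^ 2 - ‖w‖ ^ 2 ≤ 1 := by nlinarith [sq_nonneg ‖w‖]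
      calc _ ≤ ((1 - t ^ 2) ^ (n + 1))⁻¹ * 1 := by gcongr
        _ = _ := mul_one _
  refine (setLIntegral_mono' measurableSet_unitBall hle).trans_lt ?_
  rw [setLIntegral_const]
  exact ENNReal.mul_lt_top ENNReal.ofReal_lt_top Metric.isBounded_ball.measure_lt_top

lemma bumpMass_ne_zero (hα : -1 < α) {t : ℝ} (ht0 : 0 < t) (ht : t < 1) :
    bumpMass n α t ≠ 0 := by
  rw [bumpMass_eq]
  refine mul_ne_zero (volumeConst_ne_zero hα) ?_
  rw [Ne, lintegral_eq_zero_iff (by fun_prop)]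
  intro h
  have hsub : Metric.ball (0 : Cn n) t ⊆ unitBall n := Metric.ball_subset_ball ht.le
  have h0 : ∀ᵐ w ∂volume.restrict (Metric.ball (0 : Cn n) t), False := by
    filter_upwards [ae_restrict_of_ae_restrict_of_subset hsub h,
      ae_restrict_mem Metric.isOpen_ball.measurableSet] with w hw hwt
    have hwn : ‖w‖ < t := by simpa using hwt
    have h1 := one_sub_norm_sq_pos (hsub hwt)
    have h2 : 0 < t ^ 2 - ‖w‖ ^ 2 := by nlinarith [norm_nonneg w]
    rw [max_eq_right h2.le, ← ENNReal.ofReal_mul (by positivity), Pi.zero_apply,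
      ENNReal.ofReal_eq_zero] at hw
    exact hw.not_gt (by positivity)
  have h1 : volume (Metric.ball (0 : Cn n) t) = 0 := by
    simpa [Filter.eventually_false_iff_eq_bot] using h0
  exact (Metric.measure_ball_pos volume (0 : Cn n) ht0).ne' h1

lemma integrable_bump {t : ℝ} (ht0 : 0 ≤ t) (ht : t < 1) {u : Cn n} (hu : u ∈ unitBall n) :
    Integrable (bump t u) (invariantMeasure n α) := by
  refine ⟨(measurable_bump_right t u).aestronglyMeasurable, ?_⟩
  have : ∫⁻ w, ‖bump t u w‖ₑ ∂(invariantMeasure n α) = bumpMass n α t := by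
    rw [← lintegral_bump hu]
    exact lintegral_congr fun w => Real.enorm_of_nonneg (bump_nonneg t u w)
  rw [hasFiniteIntegral_iff_enorm, this]
  exact (bumpMass_ne_top ht0 ht).lt_top

lemma integral_bump {t : ℝ} {u : Cn n} (hu : u ∈ unitBall n) :
    ∫ w, bump t u w ∂(invariantMeasure n α) = (bumpMass n α t).toReal := by
  rw [integral_eq_lintegral_of_nonneg_ae (Filter.Eventually.of_forall (bump_nonneg t u))
    (measurable_bump_right t u).aestronglyMeasurable, lintegral_bump hu]

/-- Takes the place of the triangle inequality for ρ. Passing from z to u multiplies 1 - ρ(·, w)² by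
a factor R built from the quotients of the previous part, which is close to 1 uniformly in w. The
bump is a function of ρ² for this reason. -/
lemma exists_abs_pseudohyp_sq_sub_lt (n : ℕ) {ε : ℝ} (hε : 0 < ε) :
    ∃ δ > 0, ∀ z ∈ unitBall n, ∀ u ∈ unitBall n, ∀ w ∈ unitBall n, pseudohyp z u < δ →
      |pseudohyp z w ^ 2 - pseudohyp u w ^ 2| < ε := by
  have hcont : ContinuousAt (fun q : ℝ × ℂ => q.1 / ‖q.2‖ ^ 2) (1, 1) := by
    refine ContinuousAt.div (by fun_prop) (by fun_prop) (by simp)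
  obtain ⟨η, hη, hη'⟩ := Metric.continuousAt_iff.1 hcont ε hε
  obtain ⟨δ₁, hδ₁, h₁⟩ := exists_norm_one_sub_inner_div_sub_one_lt n hη
  obtain ⟨δ₂, hδ₂, h₂⟩ := exists_abs_one_sub_norm_sq_div_sub_one_lt n hη
  refine ⟨min δ₁ δ₂, lt_min hδ₁ hδ₂, fun z hz u hu w hw h => ?_⟩
  have a1 := h₁ z hz u hu w hw (h.trans_le (min_le_left _ _))
  have a2 := h₂ z hz u hu (h.trans_le (min_le_right _ _))
  have a3 := hη' (x := ((1 - ‖u‖ ^ 2) / (1 - ‖z‖ ^ 2), (1 - inner ℂ u w) / (1 - inner ℂ z w))) (by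
    rw [Prod.dist_eq]
    exact max_lt (by rwa [Real.dist_eq]) (by rwa [dist_eq_norm]))
  have p1 := one_sub_norm_sq_pos hz
  have p2 := norm_pos_iff.2 (one_sub_inner_ne_zero hz hw)
  have p3 := norm_pos_iff.2 (one_sub_inner_ne_zero hu hw)
  have q1 := one_sub_pseudohyp_sq hz hw
  have q2 := one_sub_pseudohyp_sq hu hw
  simp only [norm_one, one_pow, div_one, norm_div, Real.dist_eq] at a3
  set R := (1 - ‖u‖ ^ 2) / (1 - ‖z‖ ^ 2) / (‖1 - inner ℂ u w‖ / ‖1 - inner ℂ z w‖) ^ 2 with hR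
  have e : 1 - pseudohyp u w ^ 2 = (1 - pseudohyp z w ^ 2) * R := by
    rw [q1, q2, hR]
    field_simp
  have q0 : 0 ≤ 1 - pseudohyp z w ^ 2 := by
    nlinarith [pseudohyp_lt_one hz hw, pseudohyp_nonneg z w]
  have e2 : pseudohyp z w ^ 2 - pseudohyp u w ^ 2 = (1 - pseudohyp z w ^ 2) * (R - 1) := by
    linarith
  rw [e2, abs_mul, abs_of_nonneg q0]
  have : 1 - pseudohyp z w ^ 2 ≤ 1 := by nlinarith [sq_nonneg (pseudohyp z w)]
  nlinarith [abs_nonneg (R - 1)]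

/-- The bump is 1-Lipschitz in ρ², but a constant bound need not be integrable in w for the
invariant measure. Where either bump of radius t is nonzero, the corresponding wider bump is at
least s² - t², so the extra factor is at least 1 there and supplies integrability. -/
lemma abs_bump_sub_le {t s ε : ℝ} (ht0 : 0 ≤ t) (hts : t < s) {z u w : Cn n}
    (h : |pseudohyp z w ^ 2 - pseudohyp u w ^ 2| ≤ ε) :
    |bump t z w - bump t u w| ≤ ε * ((s ^ 2 - t ^ 2)⁻¹ * (bump s z w + bump s u w)) := by
  have hst : 0 < s ^ 2 - t ^ 2 := by nlinarith
  have hε : 0 ≤ ε := (abs_nonneg _).trans h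
  have hge : ∀ v : Cn n, bump t v w ≠ 0 → s ^ 2 - t ^ 2 ≤ bump s v w := fun v hv => by
    have h1 := pseudohyp_lt_of_bump_ne_zero ht0 hv
    have h2 := le_max_right 0 (s ^ 2 - pseudohyp v w ^ 2)
    have h3 := pseudohyp_nonneg v w
    exact le_trans (by nlinarith) h2
  have b1 := bump_nonneg s z w
  have b2 := bump_nonneg s u w
  by_cases h0 : bump t z w = 0 ∧ bump t u w = 0
  · rw [h0.1, h0.2, sub_zero, abs_zero]
    positivity
  · have hsum : s ^ 2 - t ^ 2 ≤ bump s z w + bump s u w := by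
      rw [not_and_or] at h0
      rcases h0 with h0 | h0
      · linarith [hge z h0]
      · linarith [hge u h0]
    have h1 : 1 ≤ (s ^ 2 - t ^ 2)⁻¹ * (bump s z w + bump s u w) := by
      rw [inv_mul_eq_div, one_le_div hst]
      exact hsum
    have h2 : |bump t z w - bump t u w| ≤ |pseudohyp z w ^ 2 - pseudohyp u w ^ 2| := by
      refine (abs_max_sub_max_le_max _ _ _ _).trans ?_
      rw [sub_zero, abs_zero, max_eq_right (abs_nonneg _), abs_sub_comm]
      apply le_of_eq
      congr 1
      ring
    calc _ ≤ ε * 1 := by linarith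
      _ ≤ _ := by gcongr

/-- The average of `a` over pseudohyperbolic balls of radius `t`. -/
def regularize (n : ℕ) (α t : ℝ) (a : Cn n → ℂ) (u : Cn n) : ℂ :=
  ((bumpMass n α t).toReal : ℂ)⁻¹ * ∫ w, (bump t u w : ℂ) * a w ∂(invariantMeasure n α)

lemma bumpMass_toReal_pos (hα : -1 < α) {t : ℝ} (ht0 : 0 < t) (ht : t < 1) :
    0 < (bumpMass n α t).toReal :=
  ENNReal.toReal_pos (bumpMass_ne_zero hα ht0 ht) (bumpMass_ne_top ht0.le ht)

lemma integrable_bump_mul {t : ℝ} (ht0 : 0 ≤ t) (ht : t < 1) {a : Cn n → ℂ} (ha : Measurable a)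
    {M : ℝ} (hM : ∀ w, ‖a w‖ ≤ M) {u : Cn n} (hu : u ∈ unitBall n) :
    Integrable (fun w => (bump t u w : ℂ) * a w) (invariantMeasure n α) :=
  (integrable_bump ht0 ht hu).ofReal.mul_bdd ha.aestronglyMeasurable
    (Filter.Eventually.of_forall hM)

lemma norm_regularize_le (hα : -1 < α) {t : ℝ} (ht0 : 0 < t) (ht : t < 1) {a : Cn n → ℂ}
    {M : ℝ} (hM : ∀ w, ‖a w‖ ≤ M) {u : Cn n} (hu : u ∈ unitBall n) :
    ‖regularize n α t a u‖ ≤ M := by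
  have hC := bumpMass_toReal_pos (n := n) hα ht0 ht
  rw [regularize, norm_mul, norm_inv, Complex.norm_real, Real.norm_of_nonneg hC.le,
    inv_mul_le_iff₀ hC, ← integral_bump hu, ← integral_mul_const]
  refine norm_integral_le_of_norm_le ((integrable_bump ht0.le ht hu).mul_const _) ?_
  refine Filter.Eventually.of_forall fun w => ?_
  rw [norm_mul, Complex.norm_real, Real.norm_of_nonneg (bump_nonneg _ _ _)]
  exact mul_le_mul_of_nonneg_left (hM w) (bump_nonneg _ _ _)

theorem regularize_mem_uniformSymbols (hα : -1 < α) {t : ℝ} (ht0 : 0 < t) (ht : t < 1)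
    {a : Cn n → ℂ} (ha : Measurable a) {M : ℝ} (hM : ∀ w, ‖a w‖ ≤ M) :
    regularize n α t a ∈ uniformSymbols n := by
  refine ⟨⟨M, fun z hz => norm_regularize_le hα ht0 ht hM hz⟩, fun ε hε => ?_⟩
  have hC := bumpMass_toReal_pos (n := n) hα ht0 ht
  have hM0 : 0 ≤ M := (norm_nonneg _).trans (hM 0)
  set C := (bumpMass n α t).toReal with hCdef
  -- Any radius strictly between t and 1 would do.
  set s := (1 + t) / 2 with hs
  have hts : t < s := by rw [hs]; linarith
  have hs1 : s < 1 := by rw [hs]; linarith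
  have hs0 : 0 < s := ht0.trans hts
  set S := (bumpMass n α s).toReal with hS
  have hS0 : 0 < S := bumpMass_toReal_pos hα hs0 hs1
  have hst : 0 < s ^ 2 - t ^ 2 := by nlinarith
  set B := C⁻¹ * ((s ^ 2 - t ^ 2)⁻¹ * (S + S) * M) with hB
  have hB0 : 0 ≤ B := by positivity
  -- Dividing by B + 1 also covers B = 0 and gives the strict inequality at the end.
  obtain ⟨δ, hδ, h⟩ := exists_abs_pseudohyp_sq_sub_lt n (ε := ε / (B + 1)) (by positivity)
  refine ⟨δ, hδ, fun z hz u hu hzu => ?_⟩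
  have hz' := integrable_bump_mul (α := α) ht0.le ht ha hM hz
  have hu' := integrable_bump_mul (α := α) ht0.le ht ha hM hu
  have hsz := integrable_bump (α := α) hs0.le hs1 hz
  have hsu := integrable_bump (α := α) hs0.le hs1 hu
  have key : ‖∫ w, ((bump t z w : ℂ) * a w - (bump t u w : ℂ) * a w) ∂(invariantMeasure n α)‖ ≤
      ∫ w, ε / (B + 1) * ((s ^ 2 - t ^ 2)⁻¹ * (bump s z w + bump s u w)) * M
        ∂(invariantMeasure n α) := by
    refine norm_integral_le_of_norm_le
      ((((hsz.add hsu).const_mul _).const_mul _).mul_const _) ?_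
    filter_upwards [ae_mem_unitBall_invariantMeasure] with w hw
    rw [← sub_mul, norm_mul, ← Complex.ofReal_sub, Complex.norm_real, Real.norm_eq_abs]
    have := abs_bump_sub_le ht0.le hts (h z hz u hu w hw hzu).le
    exact mul_le_mul this (hM w) (norm_nonneg _) ((abs_nonneg _).trans this)
  rw [integral_mul_const, integral_const_mul, integral_const_mul, integral_add hsz hsu,
    integral_bump hz, integral_bump hu, ← hS] at key
  rw [regularize, regularize, ← mul_sub, ← integral_sub hz' hu', norm_mul, norm_inv,
    Complex.norm_real, Real.norm_of_nonneg hC.le]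
  calc _ ≤ C⁻¹ * (ε / (B + 1) * ((s ^ 2 - t ^ 2)⁻¹ * (S + S)) * M) := by gcongr
    _ = ε * (B / (B + 1)) := by rw [hB]; ring
    _ < ε * 1 := by
      gcongr
      rw [div_lt_one (by positivity)]
      linarith
    _ = ε := mul_one ε

end Bump

/-! ### Pointwise comparison of the two Toeplitz integrals -/

section Approximation

variable {n : ℕ} {α : ℝ}

lemma ofReal_integral_norm_mul_bergmanKernel (hα : -1 < α) {f : Cn n → ℂ}
    (hi : Integrable f (weightedVolume n α)) {w : Cn n} (hw : w ∈ unitBall n) :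
    ENNReal.ofReal (∫ y, ‖f y * bergmanKernel n α w y‖ ∂(weightedVolume n α)) =
      absProjection n α (fun y => ‖f y‖ₑ) w := by
  rw [ofReal_integral_norm_eq_lintegral_enorm (integrable_mul_bergmanKernel hα hi hw),
    absProjection]
  refine lintegral_congr fun y => ?_
  rw [enorm_mul, enorm_bergmanKernel, mul_comm]

/-- Pointwise comparison of the Toeplitz operators with symbols `a` and its regularization. -/
theorem exists_enorm_bergmanProjection_sub_le (n : ℕ) {α : ℝ} (hα : -1 < α) {ε : ℝ}
    (hε : 0 < ε) : ∃ t : ℝ, 0 < t ∧ t < 1 ∧ ∀ (a : Cn n → ℂ) (M : ℝ), Measurable a →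
      (∀ w, ‖a w‖ ≤ M) → ∀ f : Cn n → ℂ, Measurable f → DifferentiableOn ℂ f (unitBall n) →
      Integrable f (weightedVolume n α) → ∀ x ∈ unitBall n,
      ‖bergmanProjection n α (fun w => a w * f w) x -
        bergmanProjection n α (fun w => regularize n α t a w * f w) x‖ₑ ≤
      ENNReal.ofReal (M * ε) *
        absProjection n α (absProjection n α fun y => ‖f y‖ₑ) x := by
  obtain ⟨δ, hδ, hosc⟩ := exists_norm_density_mul_kernel_sub_le n hα hε
  set t := min (1 / 2) δ with ht
  have ht0 : 0 < t := by positivity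
  have ht1 : t < 1 := (min_le_left _ _).trans_lt (by norm_num)
  have htδ : t ≤ δ := min_le_right _ _
  refine ⟨t, ht0, ht1, fun a M ha hM f hfm hf hi x hx => ?_⟩
  have hM0 : 0 ≤ M := (norm_nonneg _).trans (hM 0)
  have hC := bumpMass_toReal_pos (n := n) hα ht0 ht1
  have hCtop := bumpMass_ne_top (n := n) (α := α) ht0.le ht1
  have hC0 := bumpMass_ne_zero (n := n) hα ht0 ht1
  set C := (bumpMass n α t).toReal with hCdef
  let H : Cn n → ℂ := fun w => (invDensity n α w : ℂ) * (f w * bergmanKernel n α x w)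
  have hKm : Measurable (bergmanKernel n α x) := measurable_bergmanKernel.of_uncurry_left
  have hHm : Measurable H :=
    (Complex.measurable_ofReal.comp measurable_invDensity).mul (hfm.mul hKm)
  have hHi : Integrable H (invariantMeasure n α) :=
    (integrable_weightedVolume_iff hα).1 (integrable_mul_bergmanKernel hα hi hx)
  let Φ : Cn n → Cn n → ℂ := fun u w => (bump t u w : ℂ) * a w * H u
  have hΦm : Measurable fun q : Cn n × Cn n => Φ q.1 q.2 :=
    ((Complex.measurable_ofReal.comp (measurable_bump t)).mul (ha.comp measurable_snd)).mul
      (hHm.comp measurable_fst)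
  -- By Tonelli: the integral of the bump in w is the same constant for every u, which leaves the
  -- integrability of H.
  have hΦi : Integrable (Function.uncurry Φ)
      ((invariantMeasure n α).prod (invariantMeasure n α)) := by
    refine ⟨hΦm.aestronglyMeasurable, ?_⟩
    rw [hasFiniteIntegral_iff_enorm, lintegral_prod (fun q => ‖Function.uncurry Φ q‖ₑ)
      hΦm.enorm.aemeasurable]
    have hle : ∀ᵐ u ∂(invariantMeasure n α), ∫⁻ w, ‖Φ u w‖ₑ ∂(invariantMeasure n α) ≤
        bumpMass n α t * ENNReal.ofReal M * ‖H u‖ₑ := by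
      filter_upwards [ae_mem_unitBall_invariantMeasure] with u hu
      rw [← lintegral_bump hu, mul_assoc, ← lintegral_mul_const' _ _
        (ENNReal.mul_ne_top ENNReal.ofReal_ne_top enorm_ne_top)]
      refine lintegral_mono fun w => ?_
      simp only [Φ]
      rw [enorm_mul, enorm_mul, mul_assoc, ← ofReal_norm (bump t u w : ℂ), Complex.norm_real,
        Real.norm_of_nonneg (bump_nonneg _ _ _), ← ofReal_norm (a w)]
      gcongr
      exact hM w
    refine (lintegral_mono_ae hle).trans_lt ?_
    rw [lintegral_const_mul' _ _ (ENNReal.mul_ne_top hCtop ENNReal.ofReal_ne_top)]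
    exact ENNReal.mul_lt_top (ENNReal.mul_lt_top hCtop.lt_top ENNReal.ofReal_lt_top)
      hHi.hasFiniteIntegral
  -- Fubini moves the average off the symbol: for fixed w, the integrand H is now averaged near w.
  have hreg : (C : ℂ) * bergmanProjection n α (fun w => regularize n α t a w * f w) x =
      ∫ w, ∫ u, Φ u w ∂(invariantMeasure n α) ∂(invariantMeasure n α) := by
    rw [← integral_integral_swap hΦi, bergmanProjection_eq, integral_weightedVolume hα,
      ← integral_const_mul]
    refine integral_congr_ae ?_
    filter_upwards with u
    have hC' : (C : ℂ) ≠ 0 := by exact_mod_cast hC.ne'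
    simp only [Φ, H]
    rw [integral_mul_const, regularize, ← hCdef]
    field_simp
  have hfull : (C : ℂ) * bergmanProjection n α (fun w => a w * f w) x =
      ∫ w, (C : ℂ) * (a w * H w) ∂(invariantMeasure n α) := by
    rw [bergmanProjection_eq, integral_weightedVolume hα, ← integral_const_mul]
    refine integral_congr_ae ?_
    filter_upwards with u
    simp only [H]
    ring
  have haH : Integrable (fun w => (C : ℂ) * (a w * H w)) (invariantMeasure n α) :=
    (hHi.bdd_mul ha.aestronglyMeasurable (Filter.Eventually.of_forall hM)).const_mul _
  -- By symmetry of the bump, C is also its integral in u, so C a(w) H(w) can be put under the same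
  -- u-integral. What remains is a(w) times the average of H(w) - H(u), and the oscillation bound
  -- applies on the support of the bump.
  have hbound : ∀ᵐ w ∂(invariantMeasure n α),
      ‖(C : ℂ) * (a w * H w) - ∫ u, Φ u w ∂(invariantMeasure n α)‖ₑ ≤
      bumpMass n α t * (ENNReal.ofReal (M * ε) * (ENNReal.ofReal (invDensity n α w) *
        (absKernel n α x w * absProjection n α (fun y => ‖f y‖ₑ) w))) := by
    filter_upwards [ae_mem_unitBall_invariantMeasure, hΦi.swap.prod_right_ae] with w hw hΦw
    have hD0 := invDensity_pos (α := α) hw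
    have hbi : Integrable (fun u => bump t u w) (invariantMeasure n α) := by
      refine (integrable_congr ?_).2 (integrable_bump ht0.le ht1 hw)
      filter_upwards [ae_mem_unitBall_invariantMeasure] with u hu
      exact bump_comm hu hw
    have hbC : ∫ u, bump t u w ∂(invariantMeasure n α) = C := by
      rw [hCdef, ← integral_bump hw]
      refine integral_congr_ae ?_
      filter_upwards [ae_mem_unitBall_invariantMeasure] with u hu
      exact bump_comm hu hw
    have h1 : (C : ℂ) * (a w * H w) =
        ∫ u, (bump t u w : ℂ) * (a w * H w) ∂(invariantMeasure n α) := by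
      rw [integral_mul_const, integral_complex_ofReal, hbC]
    have hΦw' : Integrable (fun u => Φ u w) (invariantMeasure n α) := hΦw
    have hbi' : Integrable (fun u => (bump t u w : ℂ) * (a w * H w)) (invariantMeasure n α) :=
      hbi.ofReal.mul_const _
    rw [h1, ← integral_sub hbi' hΦw']
    refine (enorm_integral_le_lintegral_enorm _).trans ?_
    rw [← lintegral_bump_left hw, ← ofReal_integral_norm_mul_bergmanKernel hα hi hw,
      ← enorm_bergmanKernel, ← ofReal_norm (bergmanKernel n α x w),
      ← ENNReal.ofReal_mul (norm_nonneg _), ← ENNReal.ofReal_mul hD0.le,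
      ← ENNReal.ofReal_mul (by positivity), ← lintegral_mul_const' _ _ ENNReal.ofReal_ne_top]
    refine lintegral_mono_ae ?_
    filter_upwards [ae_mem_unitBall_invariantMeasure] with u hu
    rw [← ofReal_norm, ← ENNReal.ofReal_mul (bump_nonneg _ _ _)]
    refine ENNReal.ofReal_le_ofReal ?_
    by_cases hb : bump t u w = 0
    · simp [Φ, hb]
    have hρ : pseudohyp w u < δ := by
      rw [pseudohyp_comm hw hu]
      exact (pseudohyp_lt_of_bump_ne_zero ht0.le hb).trans_le htδ
    have ho := hosc f hfm hf hi w hw u hu x hx hρ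
    have e : (bump t u w : ℂ) * (a w * H w) - Φ u w = bump t u w * (a w * (H w - H u)) := by
      simp only [Φ]
      ring
    rw [e, norm_mul, norm_mul, Complex.norm_real, Real.norm_of_nonneg (bump_nonneg _ _ _)]
    refine mul_le_mul_of_nonneg_left ?_ (bump_nonneg _ _ _)
    calc ‖a w‖ * ‖H w - H u‖ ≤ M * (ε * (invDensity n α w * ‖bergmanKernel n α x w‖ *
        ∫ y, ‖f y * bergmanKernel n α w y‖ ∂(weightedVolume n α))) :=
          mul_le_mul (hM w) ho (norm_nonneg _) hM0
      _ = _ := by ring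
  have hfinal : bumpMass n α t * ‖bergmanProjection n α (fun w => a w * f w) x -
        bergmanProjection n α (fun w => regularize n α t a w * f w) x‖ₑ ≤
      bumpMass n α t * (ENNReal.ofReal (M * ε) *
        absProjection n α (absProjection n α fun y => ‖f y‖ₑ) x) := by
    have hCe : bumpMass n α t = ‖(C : ℂ)‖ₑ := by
      rw [← ofReal_norm, Complex.norm_real, Real.norm_of_nonneg hC.le, hCdef,
        ENNReal.ofReal_toReal hCtop]
    have hPm : Measurable fun w =>
        absKernel n α x w * absProjection n α (fun y => ‖f y‖ₑ) w :=
      measurable_absKernel.of_uncurry_left.mul (measurable_absProjection hfm.enorm)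
    have hΦr : Integrable (fun w => ∫ u, Φ u w ∂(invariantMeasure n α)) (invariantMeasure n α) :=
      hΦi.integral_prod_right
    conv_lhs => rw [hCe, ← enorm_mul, mul_sub, hreg, hfull,
      ← integral_sub haH hΦr]
    refine (enorm_integral_le_lintegral_enorm _).trans ((lintegral_mono_ae hbound).trans ?_)
    rw [lintegral_const_mul' _ _ hCtop, lintegral_const_mul' _ _ ENNReal.ofReal_ne_top,
      ← lintegral_weightedVolume_eq_invariantMeasure hα hPm]
    rfl
  exact (ENNReal.mul_le_mul_iff_right hC0 hCtop).1 hfinal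

end Approximation

/-! ### Toeplitz operators on the Bergman space -/

section Operators

variable {n : ℕ} {p : ℝ≥0∞} {α : ℝ}

lemma weightedVolume_absolutelyContinuous :
    weightedVolume n α ≪ volume.restrict (unitBall n) :=
  (withDensity_absolutelyContinuous _ _).trans Measure.smul_absolutelyContinuous

lemma bergmanProjection_congr {g g' : Cn n → ℂ} (h : g =ᵐ[weightedVolume n α] g') :
    bergmanProjection n α g = bergmanProjection n α g' := by
  ext z
  refine integral_congr_ae ?_
  filter_upwards [h] with w hw
  rw [hw]

lemma enorm_bergmanProjection_le (g : Cn n → ℂ) (z : Cn n) :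
    ‖bergmanProjection n α g z‖ₑ ≤ absProjection n α (fun w => ‖g w‖ₑ) z := by
  rw [bergmanProjection_eq]
  refine (enorm_integral_le_lintegral_enorm _).trans (le_of_eq (lintegral_congr fun w => ?_))
  rw [enorm_mul, enorm_bergmanKernel, mul_comm]

lemma measurable_bergmanProjection {g : Cn n → ℂ} (hg : Measurable g) :
    Measurable (bergmanProjection n α g) := by
  have : StronglyMeasurable fun q : Cn n × Cn n => g q.2 * bergmanKernel n α q.1 q.2 :=
    ((hg.comp measurable_snd).mul measurable_bergmanKernel).stronglyMeasurable
  exact (this.integral_prod_right (ν := weightedVolume n α)).measurable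

/-- The maximal Bergman projection is bounded on `L^p` for `1 < p < ∞`. -/
theorem eLpNorm_absProjection_le (hn : 1 ≤ n) (hp : 1 < p) (hp' : p ≠ ∞) (hα : -1 < α) :
    ∃ C : ℝ≥0∞, C ≠ ∞ ∧ ∀ g : Cn n → ℝ≥0∞, Measurable g →
      eLpNorm (absProjection n α g) p (weightedVolume n α) ≤
        C * eLpNorm g p (weightedVolume n α) := by
  have hP : 1 < p.toReal := by
    rw [← ENNReal.toReal_one]
    exact (ENNReal.toReal_lt_toReal ENNReal.one_ne_top hp').2 hp
  have hP0 : 0 < p.toReal := one_pos.trans hP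
  obtain ⟨C, hC, h⟩ := absProjection_rpow_le (n := n) hn hα hP
  have hp0 : p ≠ 0 := (one_pos.trans hp).ne'
  refine ⟨C ^ (1 / p.toReal), ENNReal.rpow_ne_top_of_nonneg (by positivity) hC, fun g hg => ?_⟩
  rw [eLpNorm_eq_lintegral_rpow_enorm_toReal hp0 hp',
    eLpNorm_eq_lintegral_rpow_enorm_toReal hp0 hp',
    ← ENNReal.mul_rpow_of_nonneg _ _ (by positivity)]
  simp only [enorm_eq_self]
  gcongr
  exact h g hg

lemma memLp_bergmanProjection (hn : 1 ≤ n) (hp : 1 < p) (hp' : p ≠ ∞) (hα : -1 < α) :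
    ∃ C : ℝ≥0∞, C ≠ ∞ ∧ ∀ g : Cn n → ℂ, MemLp g p (weightedVolume n α) →
      MemLp (bergmanProjection n α g) p (weightedVolume n α) ∧
      eLpNorm (bergmanProjection n α g) p (weightedVolume n α) ≤
        C * eLpNorm g p (weightedVolume n α) := by
  obtain ⟨C, hC, h⟩ := eLpNorm_absProjection_le (n := n) hn hp hp' hα
  refine ⟨C, hC, fun g hg => ?_⟩
  obtain ⟨g', hg'm, hgg'⟩ := hg.aestronglyMeasurable.aemeasurable
  rw [bergmanProjection_congr hgg', eLpNorm_congr_ae hgg']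
  have hle : eLpNorm (bergmanProjection n α g') p (weightedVolume n α) ≤
      C * eLpNorm g' p (weightedVolume n α) := by
    refine (eLpNorm_mono_enorm (g := absProjection n α fun w => ‖g' w‖ₑ) fun z => ?_).trans ?_
    · rw [enorm_eq_self]
      exact enorm_bergmanProjection_le g' z
    · refine (h _ hg'm.enorm).trans (le_of_eq ?_)
      rw [eLpNorm_enorm]
  refine ⟨⟨(measurable_bergmanProjection hg'm).aestronglyMeasurable, hle.trans_lt ?_⟩, hle⟩
  rw [← eLpNorm_congr_ae hgg']
  exact ENNReal.mul_lt_top hC.lt_top hg.eLpNorm_lt_top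

lemma BergmanSpace.memLp_toFun (f : BergmanSpace n p α) : MemLp f.toFun p (weightedVolume n α) :=
  Lp.memLp (Subtype.val f : Lp ℂ p (weightedVolume n α))

/-- A representative is arbitrary off the ball; setting it to zero there makes it Borel measurable,
as the reproducing formula requires. -/
lemma BergmanSpace.exists_holomorphic (f : BergmanSpace n p α) :
    ∃ g : Cn n → ℂ, Measurable g ∧ DifferentiableOn ℂ g (unitBall n) ∧
      f.toFun =ᵐ[weightedVolume n α] g := by
  obtain ⟨g, hg, hfg⟩ := f.2
  refine ⟨(unitBall n).indicator g, ?_, ?_, ?_⟩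
  · classical
    exact ContinuousOn.measurable_piecewise hg.continuousOn continuousOn_const
      measurableSet_unitBall
  · exact hg.congr fun z hz => indicator_of_mem hz g
  · filter_upwards [hfg, ae_mem_unitBall] with z hz hzB
    rw [indicator_of_mem hzB]
    exact hz

lemma BergmanSpace.ext_ae {f g : BergmanSpace n p α}
    (h : f.toFun =ᵐ[weightedVolume n α] g.toFun) : f = g := Subtype.ext (Lp.ext h)

/-- The element of the Bergman space defined by a holomorphic function. -/
def BergmanSpace.ofFun (h : Cn n → ℂ) (hd : DifferentiableOn ℂ h (unitBall n))
    (hm : MemLp h p (weightedVolume n α)) : BergmanSpace n p α :=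
  ⟨hm.toLp h, h, hd, hm.coeFn_toLp⟩

lemma BergmanSpace.toFun_ofFun (h : Cn n → ℂ) (hd : DifferentiableOn ℂ h (unitBall n))
    (hm : MemLp h p (weightedVolume n α)) :
    (BergmanSpace.ofFun h hd hm).toFun =ᵐ[weightedVolume n α] h := hm.coeFn_toLp

lemma memLp_symbol_mul {a : Cn n → ℂ} (ha : a ∈ boundedSymbols n α) (f : BergmanSpace n p α) :
    MemLp (fun w => a w * f.toFun w) p (weightedVolume n α) := f.memLp_toFun.mul ha

variable [Fact (1 ≤ p)]

lemma BergmanSpace.norm_eq (f : BergmanSpace n p α) :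
    ‖f‖ = (eLpNorm f.toFun p (weightedVolume n α)).toReal :=
  Lp.norm_def (Subtype.val f : Lp ℂ p (weightedVolume n α))

lemma BergmanSpace.toFun_add (f g : BergmanSpace n p α) :
    (f + g).toFun =ᵐ[weightedVolume n α] f.toFun + g.toFun :=
  Lp.coeFn_add (Subtype.val f : Lp ℂ p (weightedVolume n α)) (Subtype.val g)

lemma BergmanSpace.toFun_sub (f g : BergmanSpace n p α) :
    (f - g).toFun =ᵐ[weightedVolume n α] f.toFun - g.toFun :=
  Lp.coeFn_sub (Subtype.val f : Lp ℂ p (weightedVolume n α)) (Subtype.val g)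

lemma BergmanSpace.toFun_smul (c : ℂ) (f : BergmanSpace n p α) :
    (c • f).toFun =ᵐ[weightedVolume n α] c • f.toFun :=
  Lp.coeFn_smul c (Subtype.val f : Lp ℂ p (weightedVolume n α))

lemma MemLp.integrable_weightedVolume (hα : -1 < α) {g : Cn n → ℂ}
    (hg : MemLp g p (weightedVolume n α)) : Integrable g (weightedVolume n α) := by
  have := isFiniteMeasure_weightedVolume (n := n) hα
  exact hg.integrable Fact.out

/-- Toeplitz operators with bounded symbol exist. -/
theorem exists_isToeplitz (hn : 1 ≤ n) (hp : 1 < p) (hp' : p ≠ ∞) (hα : -1 < α) {a : Cn n → ℂ}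
    (ha : a ∈ boundedSymbols n α) :
    ∃ T : BergmanSpace n p α →L[ℂ] BergmanSpace n p α, IsToeplitz a T := by
  obtain ⟨C, hC, h⟩ := memLp_bergmanProjection (n := n) hn hp hp' hα
  have hint : ∀ f : BergmanSpace n p α,
      Integrable (fun w => a w * f.toFun w) (weightedVolume n α) := fun f =>
    MemLp.integrable_weightedVolume hα (memLp_symbol_mul ha f)
  let F : BergmanSpace n p α → BergmanSpace n p α := fun f =>
    BergmanSpace.ofFun (bergmanProjection n α fun w => a w * f.toFun w)
      (differentiableOn_bergmanProjection hα (hint f)) (h _ (memLp_symbol_mul ha f)).1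
  have hF : ∀ f, (F f).toFun =ᵐ[weightedVolume n α]
      bergmanProjection n α fun w => a w * f.toFun w := fun f => BergmanSpace.toFun_ofFun _ _ _
  let L : BergmanSpace n p α →ₗ[ℂ] BergmanSpace n p α :=
    { toFun := F
      map_add' := fun f g => by
        refine BergmanSpace.ext_ae ?_
        have e : (fun w => a w * (f + g).toFun w) =ᵐ[weightedVolume n α]
            fun w => a w * f.toFun w + a w * g.toFun w := by
          filter_upwards [BergmanSpace.toFun_add f g] with w hw
          rw [hw, Pi.add_apply, mul_add]
        filter_upwards [hF (f + g), hF f, hF g, BergmanSpace.toFun_add (F f) (F g),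
          ae_mem_unitBall] with z h1 h2 h3 h4 hz
        rw [h1, h4, Pi.add_apply, h2, h3, bergmanProjection_congr e, bergmanProjection_eq,
          bergmanProjection_eq, bergmanProjection_eq,
          ← integral_add (integrable_mul_bergmanKernel hα (hint f) hz)
            (integrable_mul_bergmanKernel hα (hint g) hz)]
        simp only [add_mul]
      map_smul' := fun c f => by
        refine BergmanSpace.ext_ae ?_
        have e : (fun w => a w * (c • f).toFun w) =ᵐ[weightedVolume n α]
            fun w => c * (a w * f.toFun w) := by
          filter_upwards [BergmanSpace.toFun_smul c f] with w hw
          rw [hw, Pi.smul_apply, smul_eq_mul, mul_left_comm]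
        filter_upwards [hF (c • f), hF f, BergmanSpace.toFun_smul c (F f)] with z h1 h2 h3
        rw [h1, RingHom.id_apply, h3, Pi.smul_apply, h2, bergmanProjection_congr e,
          bergmanProjection_eq, bergmanProjection_eq, smul_eq_mul, ← integral_const_mul]
        simp only [mul_assoc] }
  refine ⟨L.mkContinuous (C.toReal * (eLpNorm a ∞ (weightedVolume n α)).toReal) fun f => ?_, hF⟩
  change ‖F f‖ ≤ _
  rw [BergmanSpace.norm_eq, BergmanSpace.norm_eq, eLpNorm_congr_ae (hF f), mul_assoc,
    ← ENNReal.toReal_mul, ← ENNReal.toReal_mul]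
  have hprod : eLpNorm (fun w => a w * f.toFun w) p (weightedVolume n α) ≤
      eLpNorm a ∞ (weightedVolume n α) * eLpNorm f.toFun p (weightedVolume n α) :=
    eLpNorm_smul_le_eLpNorm_top_mul_eLpNorm p f.memLp_toFun.aestronglyMeasurable a
  refine ENNReal.toReal_mono ?_ ((h _ (memLp_symbol_mul ha f)).2.trans (by gcongr))
  exact ENNReal.mul_ne_top hC (ENNReal.mul_ne_top ha.eLpNorm_ne_top f.memLp_toFun.eLpNorm_ne_top)

lemma IsToeplitz.unique {a : Cn n → ℂ} {T S : BergmanSpace n p α →L[ℂ] BergmanSpace n p α}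
    (hT : IsToeplitz a T) (hS : IsToeplitz a S) : T = S :=
  ContinuousLinearMap.ext fun f => BergmanSpace.ext_ae ((hT f).trans (hS f).symm)

lemma IsToeplitz.congr {a b : Cn n → ℂ} {T : BergmanSpace n p α →L[ℂ] BergmanSpace n p α}
    (hT : IsToeplitz a T) (hab : a =ᵐ[weightedVolume n α] b) : IsToeplitz b T := fun f => by
  have e : (fun w => a w * f.toFun w) =ᵐ[weightedVolume n α] fun w => b w * f.toFun w := by
    filter_upwards [hab] with w hw
    rw [hw]
  rw [← bergmanProjection_congr e]
  exact hT f

/-- Truncating a measurable representative at the essential supremum changes it on a null set only,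
and gives the everywhere bound that the averaging lemmas assume. -/
lemma exists_bounded_measurable_symbol {a : Cn n → ℂ} (ha : a ∈ boundedSymbols n α) :
    ∃ b : Cn n → ℂ, Measurable b ∧ (∃ M : ℝ, ∀ w, ‖b w‖ ≤ M) ∧ a =ᵐ[weightedVolume n α] b := by
  obtain ⟨b, hb, hab⟩ := ha.aestronglyMeasurable.aemeasurable
  set M := (eLpNorm a ∞ (weightedVolume n α)).toReal with hM
  have hS : MeasurableSet {w | ‖b w‖ ≤ M} := measurableSet_le hb.norm measurable_const
  refine ⟨{w | ‖b w‖ ≤ M}.indicator b, hb.indicator hS, ⟨M, fun w => ?_⟩, ?_⟩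
  · by_cases hw : w ∈ {w | ‖b w‖ ≤ M}
    · rw [indicator_of_mem hw]
      exact hw
    · rw [indicator_of_notMem hw, norm_zero]
      exact ENNReal.toReal_nonneg
  · filter_upwards [hab, ae_le_eLpNormEssSup (f := a) (μ := weightedVolume n α)] with w hw hle
    rw [indicator_of_mem, hw]
    change ‖b w‖ ≤ M
    rw [← hw, ← toReal_enorm]
    refine ENNReal.toReal_mono ha.eLpNorm_ne_top ?_
    rwa [eLpNorm_exponent_top]

lemma pseudohyp_self {z : Cn n} (hz : z ∈ unitBall n) : pseudohyp z z = 0 := by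
  have h := ballAut_ballAut hz zero_mem_unitBall
  rw [ballAut_zero] at h
  rw [pseudohyp, h, norm_zero]

/-- ρ(z, ·) is continuous at z and vanishes there. The continuity supplies measurability, which is
not part of the definition of 𝒜. -/
lemma continuousOn_of_mem_uniformSymbols {a : Cn n → ℂ} (ha : a ∈ uniformSymbols n) :
    ContinuousOn a (unitBall n) := by
  intro z hz
  rw [Metric.continuousWithinAt_iff']
  intro ε hε
  obtain ⟨δ, hδ, h⟩ := ha.2 ε hε
  have hc : ContinuousAt (fun w => pseudohyp z w) z :=
    (hasFDerivAt_ballAut hz hz).continuousAt.norm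
  have hlt : ∀ᶠ w in nhds z, pseudohyp z w < δ :=
    hc.eventually_lt continuousAt_const (by rwa [pseudohyp_self hz])
  filter_upwards [nhdsWithin_le_nhds hlt, self_mem_nhdsWithin] with w hw hwB
  rw [dist_comm, dist_eq_norm]
  exact h z hz w hwB hw

lemma uniformSymbols_subset_boundedSymbols : uniformSymbols n ⊆ boundedSymbols n α := by
  intro a ha
  obtain ⟨C, hC⟩ := ha.1
  refine memLp_top_of_bound (((continuousOn_of_mem_uniformSymbols ha).aestronglyMeasurable
    measurableSet_unitBall).mono_ac weightedVolume_absolutelyContinuous) C ?_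
  filter_upwards [ae_mem_unitBall] with w hw
  exact hC w hw

/-- Toeplitz operators with bounded symbol are norm limits of Toeplitz operators with uniformly
continuous symbol. -/
theorem exists_isToeplitz_norm_sub_le (hn : 1 ≤ n) (hp : 1 < p) (hp' : p ≠ ∞) (hα : -1 < α)
    {a : Cn n → ℂ} (ha : a ∈ boundedSymbols n α)
    {T : BergmanSpace n p α →L[ℂ] BergmanSpace n p α} (hT : IsToeplitz a T) {ε : ℝ} (hε : 0 < ε) :
    ∃ b ∈ uniformSymbols n, ∃ S : BergmanSpace n p α →L[ℂ] BergmanSpace n p α,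
      IsToeplitz b S ∧ ‖T - S‖ ≤ ε := by
  obtain ⟨a', ha'm, ⟨M, hM⟩, haa'⟩ := exists_bounded_measurable_symbol ha
  have hT' := hT.congr haa'
  have hM0 : 0 ≤ M := (norm_nonneg _).trans (hM 0)
  obtain ⟨C, hC, hCle⟩ := eLpNorm_absProjection_le (n := n) hn hp hp' hα
  -- With accuracy ε/(B+1) the pointwise estimate and two applications of the L^p bound for the
  -- maximal projection give operator norm at most εB/(B+1).
  set B := M * (C.toReal * C.toReal) with hB
  have hB0 : 0 ≤ B := by positivity
  obtain ⟨t, ht0, ht1, happ⟩ := exists_enorm_bergmanProjection_sub_le n hα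
    (ε := ε / (B + 1)) (by positivity)
  have hb := regularize_mem_uniformSymbols hα ht0 ht1 ha'm hM
  obtain ⟨S, hS⟩ := exists_isToeplitz (p := p) hn hp hp' hα
    (uniformSymbols_subset_boundedSymbols (α := α) hb)
  refine ⟨_, hb, S, hS, ContinuousLinearMap.opNorm_le_bound _ hε.le fun f => ?_⟩
  obtain ⟨g, hgm, hgd, hfg⟩ := f.exists_holomorphic
  have hgp : MemLp g p (weightedVolume n α) := (memLp_congr_ae hfg).1 f.memLp_toFun
  have hgi := MemLp.integrable_weightedVolume hα hgp
  have hmul : ∀ b : Cn n → ℂ, (fun w => b w * f.toFun w) =ᵐ[weightedVolume n α]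
      fun w => b w * g w := fun b => by
    filter_upwards [hfg] with w hw
    rw [hw]
  have hpt : ∀ᵐ x ∂(weightedVolume n α), ‖(T f - S f).toFun x‖ₑ ≤
      (Real.toNNReal (M * (ε / (B + 1))) : ℝ≥0∞) *
        ‖absProjection n α (absProjection n α fun y => ‖g y‖ₑ) x‖ₑ := by
    filter_upwards [BergmanSpace.toFun_sub (T f) (S f), hT' f, hS f, ae_mem_unitBall]
      with x h1 h2 h3 hx
    rw [h1, Pi.sub_apply, h2, h3, bergmanProjection_congr (hmul _),
      bergmanProjection_congr (hmul _), enorm_eq_self]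
    exact happ a' M ha'm hM g hgm hgd hgi x hx
  have hle : eLpNorm (T f - S f).toFun p (weightedVolume n α) ≤
      ENNReal.ofReal (M * (ε / (B + 1))) * (C * (C * eLpNorm g p (weightedVolume n α))) := by
    refine (eLpNorm_le_nnreal_smul_eLpNorm_of_ae_le_mul' hpt p).trans ?_
    rw [ENNReal.smul_def, smul_eq_mul]
    change ENNReal.ofReal _ * _ ≤ _
    gcongr
    refine (hCle _ (measurable_absProjection hgm.enorm)).trans ?_
    gcongr
    exact (hCle _ hgm.enorm).trans (le_of_eq (by rw [eLpNorm_enorm]))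
  change ‖T f - S f‖ ≤ _
  rw [BergmanSpace.norm_eq, BergmanSpace.norm_eq, eLpNorm_congr_ae hfg]
  have hfin : ENNReal.ofReal (M * (ε / (B + 1))) * (C * (C * eLpNorm g p (weightedVolume n α))) ≠ ∞ :=
    ENNReal.mul_ne_top ENNReal.ofReal_ne_top
      (ENNReal.mul_ne_top hC (ENNReal.mul_ne_top hC hgp.eLpNorm_ne_top))
  refine (ENNReal.toReal_mono hfin hle).trans ?_
  rw [ENNReal.toReal_mul, ENNReal.toReal_mul, ENNReal.toReal_mul,
    ENNReal.toReal_ofReal (by positivity)]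
  have hB1 : B / (B + 1) ≤ 1 := by
    rw [div_le_one (by positivity)]
    linarith
  calc _ = ε * (B / (B + 1)) * (eLpNorm g p (weightedVolume n α)).toReal := by rw [hB]; ring
    _ ≤ ε * 1 * (eLpNorm g p (weightedVolume n α)).toReal := by gcongr
    _ = _ := by rw [mul_one]

theorem closedToeplitzAlgebra_mono {A B : Set (Cn n → ℂ)} (h : A ⊆ B) :
    closedToeplitzAlgebra p α A ≤ closedToeplitzAlgebra p α B :=
  NonUnitalSubalgebra.topologicalClosure_mono
    (NonUnitalAlgebra.adjoin_mono fun _ ⟨a, ha, hT⟩ => ⟨a, h ha, hT⟩)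

/-- The right side is a closed subalgebra, so it suffices that it contains each generator T_a; these
are limits of generators of the right side. -/
theorem toeplitzAlgebra_le (hn : 1 ≤ n) (hp : 1 < p) (hp' : p ≠ ∞) (hα : -1 < α) :
    toeplitzAlgebra n p α ≤ closedToeplitzAlgebra p α (uniformSymbols n) := by
  refine NonUnitalSubalgebra.topologicalClosure_minimal (NonUnitalAlgebra.adjoin_le ?_)
    (NonUnitalSubalgebra.isClosed_topologicalClosure _)
  rintro T ⟨a, ha, hT⟩
  refine Metric.mem_closure_iff.2 fun ε hε => ?_
  obtain ⟨b, hb, S, hS, hTS⟩ := exists_isToeplitz_norm_sub_le hn hp hp' hα ha hT (half_pos hε)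
  refine ⟨S, NonUnitalAlgebra.subset_adjoin ℂ ⟨b, hb, hS⟩, ?_⟩
  rw [dist_eq_norm]
  linarith

end Operators

end Bergman

end

theorem theorem4p4 (n : ℕ) (hn : 1 ≤ n) (p : ℝ≥0∞) [Fact (1 ≤ p)] (hp : 1 < p) (hp' : p ≠ ∞)
    (α : ℝ) (hα : -1 < α) :
    (∀ a ∈ Bergman.boundedSymbols n α,
      ∃! T : Bergman.BergmanSpace n p α →L[ℂ] Bergman.BergmanSpace n p α,
        Bergman.IsToeplitz a T) ∧
    Bergman.toeplitzAlgebra n p α =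
      Bergman.closedToeplitzAlgebra p α (Bergman.uniformSymbols n) := by
  refine ⟨fun a ha => ?_, le_antisymm (Bergman.toeplitzAlgebra_le hn hp hp' hα)
    (Bergman.closedToeplitzAlgebra_mono Bergman.uniformSymbols_subset_boundedSymbols)⟩
  obtain ⟨T, hT⟩ := Bergman.exists_isToeplitz (p := p) hn hp hp' hα ha
  exact ⟨T, hT, fun S hS => hS.unique hT⟩
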